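/- Let $A\in\mathbb{Q}^{n\times n}$ be expanding (all complex eigenvalues satisfy $|z|>1$) and put $B:=A^{-1}$. For an invertible $C\in\mathbb{Q}^{n\times n}$ let $\mathbb{Z}^n[C]:=\sum_{k\ge 0}C^k\mathbb{Z}^n\subset\mathbb{Q}^n$ and $\mathbb{Z}^n(C):=\sum_{k\in\mathbb{Z}}C^k\mathbb{Z}^n$, and let $b:=|\mathbb{Z}^n[B]/B\,\mathbb{Z}^n[B]|$. For $y\in\mathbb{Z}^n(B)$ let $\nu(y)$ be the minimal $k\in\mathbb{Z}$ with $y\in B^k\mathbb{Z}^n[B]\setminus B^{k+1}\mathbb{Z}^n[B]$, with $\nu(y)=\infty$ if there is no such $k$ (in particular $\nu(0)=\infty$), and let $\mathbf{d}_B(y,y'):=b^{-\nu(y-y')}$, where $b^{-\infty}:=0$. Let $\mathbb{Z}^n((B))$ be the (Hausdorff) completion of $\mathbb{Z}^n(B)$ with respect to the (pseudo)metric $\mathbf{d}_B$, on which $A$ acts by continuous extension, and let $\mu_B$ be the Haar measure on $\mathbb{Z}^n((B))$ that gives measure $1$ to $\mathbb{Z}^n[[B]]=\{y:\nu(y)\ge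 0\}$, where $\nu$ is extended continuously. Let $\mathbb{K}_A:=\mathbb{R}^n\times\mathbb{Z}^n((B))$ with the product topology, the action $A(x,y):=(Ax,Ay)$ and the measure $\mu:=\lambda\times\mu_B$, $\lambda$ being Lebesgue measure, and let $\varphi:\mathbb{Z}^n(B)\to\mathbb{K}_A$, $\varphi(x):=(x,x)$. Let $\mathcal{D}\subset\mathbb{Z}^n[A]$ be a finite set with $|\mathcal{D}|=|\mathbb{Z}^n[A]/A\,\mathbb{Z}^n[A]|$; that is, $(A,\mathcal{D})$ is a digit system. Then there is a unique nonempty compact set $\mathcal{F}=\mathcal{F}(A,\mathcal{D})\subset\mathbb{K}_A$ with $$A\mathcal{F}=\bigcup_{d\in\mathcal{D}}(\mathcal{F}+\varphi(d)),$$ and for this set $\mathcal{F}$ the following are equivalent: (i) $\mu(\mathcal{F})>0$; (ii) $\mathcal{F}$ has nonempty interior in $\mathbb{K}_A$; (iii) $\mathcal{F}$ is the closure of its interior, and $\mu(\partial\mathcal{F})=0$. -/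

import Mathlib

noncomputable section

namespace RationalTile

open MeasureTheory UniformSpace

variable {n : ℕ}

/-! ### Expanding matrices and the associated modules -/

/-- All (complex) eigenvalues of `A` have modulus greater than `1`. -/
def IsExpanding (A : Matrix (Fin n) (Fin n) ℚ) : Prop :=
  ∀ z ∈ spectrum ℂ (A.map (algebraMap ℚ ℂ)), 1 < ‖z‖

/-- Expanding rational `n × n` matrices. -/
abbrev ExpandingMatrix (n : ℕ) : Type :=
  {A : Matrix (Fin n) (Fin n) ℚ // IsExpanding A}

/-- Multiplication by `C` on `ℚⁿ`. -/
def matMap (C : Matrix (Fin n) (Fin n) ℚ) : (Fin n → ℚ) →+ (Fin n → ℚ) :=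
  C.mulVecLin.toAddMonoidHom

/-- The inclusion `ℤⁿ → ℚⁿ`. -/
def castVec (n : ℕ) : (Fin n → ℤ) →+ (Fin n → ℚ) :=
  (Int.castAddHom ℚ).compLeft (Fin n)

/-- `ℤⁿ` as a subgroup of `ℚⁿ`. -/
def intVectors (n : ℕ) : AddSubgroup (Fin n → ℚ) := (castVec n).range

/-- `ℤⁿ[C]`, the sum of all `Cᵏ ℤⁿ` with `k ≥ 0`. -/
def polyModule (C : Matrix (Fin n) (Fin n) ℚ) : AddSubgroup (Fin n → ℚ) :=
  ⨆ k : ℕ, (intVectors n).map (matMap (C ^ k))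

/-- `ℤⁿ(C)`, the sum of all `Cᵏ ℤⁿ` with `k ∈ ℤ`. -/
def laurentModule (C : Matrix (Fin n) (Fin n) ℚ) : AddSubgroup (Fin n → ℚ) :=
  ⨆ k : ℤ, (intVectors n).map (matMap (C ^ k))

/-- The order of the quotient group `ℤⁿ[C] / C ℤⁿ[C]`. -/
def residueCard (C : Matrix (Fin n) (Fin n) ℚ) : ℕ :=
  Nat.card (polyModule C ⧸ ((polyModule C).map (matMap C)).addSubgroupOf (polyModule C))

/-- `Cᵏ ℤⁿ[C]`, for `k ∈ ℤ`. -/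
def filt (C : Matrix (Fin n) (Fin n) ℚ) (k : ℤ) : AddSubgroup (Fin n → ℚ) :=
  (polyModule C).map (matMap (C ^ k))

open Classical in
/-- The `C`-adic valuation: the minimal `k` with `y ∈ Cᵏ ℤⁿ[C] \ Cᵏ⁺¹ ℤⁿ[C]`, and `∞` if there
is no such `k`, that is, if `y` lies in every `Cᵏ ℤⁿ[C]` (in particular if `y = 0`). -/
def adicVal (C : Matrix (Fin n) (Fin n) ℚ) (y : Fin n → ℚ) : WithTop ℤ :=
  if ∃ k : ℤ, y ∈ filt C k ∧ y ∉ filt C (k + 1) then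
    ((sInf {k : ℤ | y ∈ filt C k ∧ y ∉ filt C (k + 1)} : ℤ) : WithTop ℤ)
  else ⊤

/-- `b ^ (-ν y)` where `b` is the order of `ℤⁿ[C] / C ℤⁿ[C]` and `b ^ (-∞) = 0`. -/
def adicAbs (C : Matrix (Fin n) (Fin n) ℚ) (y : Fin n → ℚ) : ℝ :=
  WithTop.recTopCoe 0 (fun k : ℤ => (residueCard C : ℝ) ^ (-k)) (adicVal C y)

/-! ### Auxiliary facts about the modules and the valuation -/

theorem matMap_apply (C : Matrix (Fin n) (Fin n) ℚ) (v : Fin n → ℚ) :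
    matMap C v = C.mulVec v := rfl

theorem matMap_comp (C C' : Matrix (Fin n) (Fin n) ℚ) :
    (matMap C).comp (matMap C') = matMap (C * C') := by
  refine AddMonoidHom.ext fun v => ?_
  simp [matMap_apply, Matrix.mulVec_mulVec]

theorem matMap_one : matMap (1 : Matrix (Fin n) (Fin n) ℚ) = AddMonoidHom.id _ := by
  refine AddMonoidHom.ext fun v => ?_
  simp [matMap_apply]

theorem residueCard_eq (C : Matrix (Fin n) (Fin n) ℚ) :
    residueCard C = ((polyModule C).map (matMap C)).relIndex (polyModule C) := rfl

theorem isUnit_det (A : ExpandingMatrix n) : IsUnit A.1.det := by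
  rw [isUnit_iff_ne_zero]
  intro h0
  have h : (0 : ℂ) ∈ spectrum ℂ (A.1.map (algebraMap ℚ ℂ)) := by
    rw [spectrum.zero_mem_iff, Matrix.isUnit_iff_isUnit_det]
    have : (A.1.map (algebraMap ℚ ℂ)).det = algebraMap ℚ ℂ A.1.det :=
      ((algebraMap ℚ ℂ).map_det A.1).symm
    rw [this, h0]
    simp
  have := A.2 0 h
  simp at this
  linarith

theorem isUnit_det_inv (A : ExpandingMatrix n) : IsUnit (A.1⁻¹).det :=
  Matrix.isUnit_nonsing_inv_det _ (isUnit_det A)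

section facts

variable {C : Matrix (Fin n) (Fin n) ℚ}

theorem filt_zero : filt C 0 = polyModule C := by
  simp [filt, matMap_one]

theorem intVectors_le : intVectors n ≤ polyModule C := by
  have := le_iSup (fun k : ℕ => (intVectors n).map (matMap (C ^ k))) 0
  simp only [pow_zero, matMap_one, AddSubgroup.map_id] at this
  exact this

theorem polyModule_eq_sup :
    polyModule C = intVectors n ⊔ (polyModule C).map (matMap C) := by
  unfold polyModule
  rw [AddSubgroup.map_iSup]
  simp only [AddSubgroup.map_map, matMap_comp]
  conv_lhs => rw [← sup_iSup_nat_succ]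
  simp [matMap_one, pow_succ']

theorem map_polyModule_le : (polyModule C).map (matMap C) ≤ polyModule C := by
  conv_rhs => rw [polyModule_eq_sup]
  exact le_sup_right

theorem map_filt (hC : IsUnit C.det) (j k : ℤ) :
    (filt C k).map (matMap (C ^ j)) = filt C (j + k) := by
  rw [filt, filt, AddSubgroup.map_map, matMap_comp, Matrix.zpow_add hC]

theorem map_filt_one (hC : IsUnit C.det) (k : ℤ) :
    (filt C k).map (matMap C) = filt C (k + 1) := by
  have := map_filt hC 1 k
  rwa [zpow_one, add_comm] at this

theorem filt_succ_le (hC : IsUnit C.det) (k : ℤ) : filt C (k + 1) ≤ filt C k := by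
  have h1 : filt C (k + 1) = (filt C 1).map (matMap (C ^ k)) := (map_filt hC k 1).symm
  have h2 : filt C 1 = (polyModule C).map (matMap C) := by simp [filt]
  rw [h1, h2, filt]
  exact AddSubgroup.map_mono map_polyModule_le

theorem filt_antitone (hC : IsUnit C.det) : Antitone (filt C) :=
  antitone_int_of_succ_le (filt_succ_le hC)

theorem matMap_injective (hC : IsUnit C.det) : Function.Injective (matMap C) :=
  Matrix.mulVec_injective_of_isUnit ((Matrix.isUnit_iff_isUnit_det C).2 hC)

theorem relIndex_filt_succ (hC : IsUnit C.det) (k : ℤ) :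
    (filt C (k + 1)).relIndex (filt C k) = residueCard C := by
  have h1 : filt C (k + 1) = (filt C 1).map (matMap (C ^ k)) := (map_filt hC k 1).symm
  have h2 : filt C 1 = (polyModule C).map (matMap C) := by simp [filt]
  have h3 : Function.Injective (matMap (C ^ k)) := matMap_injective (hC.det_zpow k)
  rw [h1, h2, filt, AddSubgroup.relIndex_map_map_of_injective _ _ h3, residueCard_eq]

/-- The residue group of `ℤⁿ[C]` modulo `C` is finite. -/
theorem residueCard_ne_zero (hC : IsUnit C.det) : residueCard C ≠ 0 := by
  rw [residueCard_eq]
  have e : ((polyModule C).map (matMap C)).relIndex (polyModule C)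
      = ((polyModule C).map (matMap C)).relIndex (intVectors n) := by
    conv_lhs => arg 2; rw [polyModule_eq_sup]
    exact AddSubgroup.relIndex_sup_right _ _
  rw [e, intVectors, ← AddSubgroup.index_comap]
  set N := ((polyModule C).map (matMap C)).comap (castVec n) with hN
  obtain ⟨c, hc⟩ := IsLocalization.exist_integer_multiples_of_finite (nonZeroDivisors ℤ)
    (fun p : Fin n × Fin n => C⁻¹ p.1 p.2)
  choose g hg using hc
  have hmem : ∀ v : Fin n → ℤ, (c : ℤ) • v ∈ N := by
    intro v
    rw [hN, AddSubgroup.mem_comap]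
    refine ⟨castVec n ((Matrix.of fun i j => g (i, j)).mulVec v),
      intVectors_le ⟨_, rfl⟩, ?_⟩
    have h : castVec n ((Matrix.of fun i j => g (i, j)).mulVec v)
        = C⁻¹.mulVec (castVec n ((c : ℤ) • v)) := by
      ext i
      simp only [castVec, AddMonoidHom.compLeft_apply, Function.comp, Matrix.mulVec, dotProduct,
        Matrix.of_apply, Int.coe_castAddHom, Int.cast_sum, Int.cast_mul, Pi.smul_apply]
      refine Finset.sum_congr rfl fun j _ => ?_
      have := hg (i, j)
      simp at this
      rw [this]
      simp only [smul_eq_mul, Int.cast_mul]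
      ring
    rw [h, matMap_apply, Matrix.mulVec_mulVec, Matrix.mul_nonsing_inv _ hC, Matrix.one_mulVec]
  have hfin : Finite ((Fin n → ℤ) ⧸ N) := by
    have : Module.Finite ℤ ((Fin n → ℤ) ⧸ N) :=
      Module.Finite.of_surjective (QuotientAddGroup.mk' N).toIntLinearMap
        (QuotientAddGroup.mk'_surjective N)
    refine Module.finite_of_fg_torsion _ ?_
    intro x
    obtain ⟨v, rfl⟩ := QuotientAddGroup.mk'_surjective N x
    refine ⟨c, ?_⟩
    have : (c : ℤ) • (QuotientAddGroup.mk' N v) = 0 := by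
      rw [← map_zsmul]
      exact (QuotientAddGroup.eq_zero_iff _).2 (hmem v)
    exact this
  exact AddSubgroup.index_ne_zero_of_finite

theorem exists_mem_filt (hC : IsUnit C.det) {y : Fin n → ℚ} (hy : y ∈ laurentModule C) :
    ∃ k : ℤ, y ∈ filt C k := by
  refine AddSubgroup.iSup_induction _ (C := fun y => ∃ k : ℤ, y ∈ filt C k) hy ?_ ?_ ?_
  · intro k x hx
    exact ⟨k, AddSubgroup.map_mono intVectors_le hx⟩
  · exact ⟨0, zero_mem _⟩
  · rintro x y ⟨j, hj⟩ ⟨k, hk⟩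
    exact ⟨min j k, add_mem (filt_antitone hC (min_le_left _ _) hj)
      (filt_antitone hC (min_le_right _ _) hk)⟩

theorem one_le_residueCard (hC : IsUnit C.det) : (1 : ℝ) ≤ residueCard C := by
  exact_mod_cast Nat.one_le_iff_ne_zero.2 (residueCard_ne_zero hC)

theorem adicVal_eq (hC : IsUnit C.det) {y : Fin n → ℚ} {k : ℤ} (h1 : y ∈ filt C k)
    (h2 : y ∉ filt C (k + 1)) : adicVal C y = k := by
  have h : {k : ℤ | y ∈ filt C k ∧ y ∉ filt C (k + 1)} = {k} := by
    ext j
    simp only [Set.mem_ofPred_eq, Set.mem_singleton_iff]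
    refine ⟨fun ⟨h3, h4⟩ => ?_, fun h => h ▸ ⟨h1, h2⟩⟩
    by_contra hne
    rcases lt_or_gt_of_ne hne with h | h
    · exact h4 (filt_antitone hC (by omega) h1)
    · exact h2 (filt_antitone hC (by omega) h3)
  rw [adicVal, if_pos ⟨k, h1, h2⟩, h, csInf_singleton]

theorem adicAbs_eq (hC : IsUnit C.det) {y : Fin n → ℚ} {k : ℤ} (h1 : y ∈ filt C k)
    (h2 : y ∉ filt C (k + 1)) : adicAbs C y = (residueCard C : ℝ) ^ (-k) := by
  rw [adicAbs, adicVal_eq hC h1 h2]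
  rfl

theorem adicAbs_eq_zero {y : Fin n → ℚ} (h : ∀ k, y ∈ filt C k) : adicAbs C y = 0 := by
  rw [adicAbs, adicVal, if_neg]
  · rfl
  · rintro ⟨k, -, h2⟩
    exact h2 (h _)

theorem exists_level (hC : IsUnit C.det) {y : Fin n → ℚ} {j k : ℤ} (hj : y ∈ filt C j)
    (hk : y ∉ filt C k) : ∃ m, m < k ∧ y ∈ filt C m ∧ y ∉ filt C (m + 1) := by
  by_contra! hcon
  have h : ∀ i : ℕ, j + i ≤ k → y ∈ filt C (j + i) := by
    intro i
    induction i with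
    | zero => intro _; simpa using hj
    | succ i ih =>
      intro h
      have := hcon (j + i) (by push_cast at h; omega) (ih (by push_cast at h; omega))
      convert this using 2
      push_cast
      ring
  rcases le_total j k with h1 | h1
  · have := h (k - j).toNat (by omega)
    apply hk
    convert this using 2
    omega
  · exact hk (filt_antitone hC h1 hj)

theorem adicAbs_cases (hC : IsUnit C.det) {y : Fin n → ℚ} (hy : y ∈ laurentModule C) :
    ((∀ k, y ∈ filt C k) ∧ adicAbs C y = 0) ∨
      ∃ k, y ∈ filt C k ∧ y ∉ filt C (k + 1) ∧ adicAbs C y = (residueCard C : ℝ) ^ (-k) := by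
  by_cases h : ∀ k, y ∈ filt C k
  · exact Or.inl ⟨h, adicAbs_eq_zero h⟩
  · push Not at h
    obtain ⟨k, hk⟩ := h
    obtain ⟨j, hj⟩ := exists_mem_filt hC hy
    obtain ⟨m, -, h1, h2⟩ := exists_level hC hj hk
    exact Or.inr ⟨m, h1, h2, adicAbs_eq hC h1 h2⟩

theorem adicAbs_le_of_mem (hC : IsUnit C.det) {y : Fin n → ℚ} {k : ℤ} (h : y ∈ filt C k) :
    adicAbs C y ≤ (residueCard C : ℝ) ^ (-k) := by
  have hb := one_le_residueCard hC
  by_cases h' : ∀ j, y ∈ filt C j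
  · rw [adicAbs_eq_zero h']
    positivity
  · push Not at h'
    obtain ⟨j, hj⟩ := h'
    obtain ⟨m, -, h1, h2⟩ := exists_level hC h hj
    rw [adicAbs_eq hC h1 h2]
    refine zpow_le_zpow_right₀ hb ?_
    by_contra hlt
    exact h2 (filt_antitone hC (by omega) h)

theorem adicAbs_nonneg (y : Fin n → ℚ) : 0 ≤ adicAbs C y := by
  rw [adicAbs]
  induction adicVal C y using WithTop.recTopCoe with
  | top => simp
  | coe k => simp only [WithTop.recTopCoe_coe]; positivity

theorem adicAbs_neg (y : Fin n → ℚ) : adicAbs C (-y) = adicAbs C y := by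
  have h : adicVal C (-y) = adicVal C y := by
    have hs : ∀ k : ℤ, (-y ∈ filt C k ∧ -y ∉ filt C (k + 1)) ↔
        (y ∈ filt C k ∧ y ∉ filt C (k + 1)) := fun k => by simp only [neg_mem_iff]
    unfold adicVal
    by_cases h : ∃ k : ℤ, y ∈ filt C k ∧ y ∉ filt C (k + 1)
    · rw [if_pos h, if_pos ((exists_congr hs).2 h)]
      simp only [hs]
    · rw [if_neg h, if_neg (fun h' => h ((exists_congr hs).1 h'))]
  rw [adicAbs, adicAbs, h]

theorem adicAbs_add (hC : IsUnit C.det) {x y : Fin n → ℚ} (hx : x ∈ laurentModule C)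
    (hy : y ∈ laurentModule C) : adicAbs C (x + y) ≤ max (adicAbs C x) (adicAbs C y) := by
  rcases adicAbs_cases hC hx with ⟨h1, e1⟩ | ⟨j, h1, -, e1⟩ <;>
    rcases adicAbs_cases hC hy with ⟨h2, e2⟩ | ⟨k, h2, -, e2⟩ <;> rw [e1, e2]
  · rw [adicAbs_eq_zero fun k => add_mem (h1 k) (h2 k)]
    simp
  · exact le_max_of_le_right (adicAbs_le_of_mem hC (add_mem (h1 k) h2))
  · exact le_max_of_le_left (adicAbs_le_of_mem hC (add_mem h1 (h2 j)))
  · rcases le_total j k with h | h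
    · exact le_max_of_le_left (adicAbs_le_of_mem hC (add_mem h1 (filt_antitone hC h h2)))
    · exact le_max_of_le_right (adicAbs_le_of_mem hC (add_mem (filt_antitone hC h h1) h2))

theorem adicAbs_matMap_inv (hC : IsUnit C.det) (y : Fin n → ℚ) (hy : y ∈ laurentModule C) :
    adicAbs C (matMap C⁻¹ y) = residueCard C * adicAbs C y := by
  have hb : (residueCard C : ℝ) ≠ 0 := by exact_mod_cast residueCard_ne_zero hC
  have key : ∀ k : ℤ, matMap C⁻¹ y ∈ filt C k ↔ y ∈ filt C (k + 1) := by
    intro k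
    rw [← map_filt_one hC k]
    have e : matMap C (matMap C⁻¹ y) = y := by
      simp [matMap_apply, Matrix.mulVec_mulVec, Matrix.mul_nonsing_inv _ hC]
    conv_rhs => rw [← e]
    exact (AddSubgroup.mem_map_iff_mem (matMap_injective hC)).symm
  rcases adicAbs_cases hC hy with ⟨h, e⟩ | ⟨k, h1, h2, e⟩
  · rw [e, adicAbs_eq_zero fun k => (key k).2 (h _), mul_zero]
  · have h1' : matMap C⁻¹ y ∈ filt C (k - 1) := (key _).2 (by simpa using h1)
    have h2' : matMap C⁻¹ y ∉ filt C (k - 1 + 1) := fun h => h2 (by simpa using (key _).1 h)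
    rw [e, adicAbs_eq hC h1' h2', neg_sub, sub_eq_add_neg, zpow_add₀ hb, zpow_one]

theorem matMap_inv_mem (hC : IsUnit C.det) {y : Fin n → ℚ} (hy : y ∈ laurentModule C) :
    matMap C⁻¹ y ∈ laurentModule C := by
  have h : (laurentModule C).map (matMap C⁻¹) ≤ laurentModule C := by
    rw [laurentModule, AddSubgroup.map_iSup]
    refine iSup_le fun k => ?_
    rw [AddSubgroup.map_map, matMap_comp]
    have : C⁻¹ * C ^ k = C ^ (-1 + k) := by rw [Matrix.zpow_add hC, Matrix.zpow_neg_one]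
    rw [this]
    exact le_iSup (fun k : ℤ => (intVectors n).map (matMap (C ^ k))) (-1 + k)
  exact h ⟨y, hy, rfl⟩

theorem polyModule_inv_le (hC : IsUnit C.det) : polyModule C⁻¹ ≤ laurentModule C := by
  refine iSup_le fun k => ?_
  have : C⁻¹ ^ k = C ^ (-(k : ℤ)) := by rw [Matrix.zpow_neg hC, zpow_natCast, Matrix.inv_pow']
  rw [this]
  exact le_iSup (fun k : ℤ => (intVectors n).map (matMap (C ^ k))) _

theorem filt_le_laurent (hC : IsUnit C.det) (k : ℤ) : filt C k ≤ laurentModule C := by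
  rw [filt, polyModule, AddSubgroup.map_iSup]
  refine iSup_le fun j => ?_
  rw [AddSubgroup.map_map, matMap_comp, ← zpow_natCast, ← Matrix.zpow_add hC]
  exact le_iSup (fun k : ℤ => (intVectors n).map (matMap (C ^ k))) _

theorem relIndex_filt_ne_zero (hC : IsUnit C.det) (k : ℕ) :
    (filt C k).relIndex (filt C 0) ≠ 0 := by
  induction k with
  | zero => simp
  | succ k ih =>
    rw [← AddSubgroup.relIndex_mul_relIndex (filt C ((k + 1 : ℕ) : ℤ)) (filt C k) (filt C 0)
      (filt_antitone hC (by push_cast; omega)) (filt_antitone hC (by omega))]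
    refine mul_ne_zero ?_ ih
    push_cast
    rw [relIndex_filt_succ hC]
    exact residueCard_ne_zero hC

end facts

/-! ### The space of `B`-adic series, `B = A⁻¹` -/

/-- The group `ℤⁿ(B)`, `B = A⁻¹`; as a type of its own, since its metric is not the one
inherited from `ℚⁿ`. -/
def LaurentGroup (A : ExpandingMatrix n) : Type := laurentModule (A.1⁻¹)

instance (A : ExpandingMatrix n) : AddCommGroup (LaurentGroup A) :=
  inferInstanceAs (AddCommGroup (laurentModule (A.1⁻¹)))

/-- The inclusion `ℤⁿ(B) → ℚⁿ`. -/
def LaurentGroup.val (A : ExpandingMatrix n) : LaurentGroup A →+ (Fin n → ℚ) :=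
  (laurentModule (A.1⁻¹)).subtype

/-- The (pseudo)metric `d_B(y, y') = b ^ (-ν(y - y'))` on `ℤⁿ(B)`. -/
instance (A : ExpandingMatrix n) : SeminormedAddCommGroup (LaurentGroup A) :=
  AddGroupSeminorm.toSeminormedAddCommGroup
    { toFun := fun y => adicAbs (A.1⁻¹) (LaurentGroup.val A y)
      map_zero' := by
        rw [map_zero]
        exact adicAbs_eq_zero fun k => zero_mem _
      add_le' := fun x y => by
        rw [map_add]
        exact (adicAbs_add (isUnit_det_inv A) x.2 y.2).trans
          (max_le_add_of_nonneg (adicAbs_nonneg _) (adicAbs_nonneg _))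
      neg' := fun y => by rw [map_neg, adicAbs_neg] }

theorem LaurentGroup.norm_def (A : ExpandingMatrix n) (y : LaurentGroup A) :
    ‖y‖ = adicAbs (A.1⁻¹) (LaurentGroup.val A y) := rfl

theorem LaurentGroup.dist_def (A : ExpandingMatrix n) (y y' : LaurentGroup A) :
    dist y y' = adicAbs (A.1⁻¹) (LaurentGroup.val A y - LaurentGroup.val A y') := by
  rw [dist_eq_norm, LaurentGroup.norm_def, map_sub]

/-- Multiplication by `A` on `ℤⁿ(B)`. -/
def LaurentGroup.mulA (A : ExpandingMatrix n) : LaurentGroup A →+ LaurentGroup A :=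
  ((matMap A.1).comp (laurentModule (A.1⁻¹)).subtype).codRestrict (laurentModule (A.1⁻¹))
    fun y => by
      have h := matMap_inv_mem (isUnit_det_inv A) y.2
      rwa [Matrix.nonsing_inv_nonsing_inv _ (isUnit_det A)] at h

theorem LaurentGroup.continuous_mulA (A : ExpandingMatrix n) :
    Continuous (LaurentGroup.mulA A) := by
  refine AddMonoidHomClass.continuous_of_bound (LaurentGroup.mulA A)
    (residueCard (A.1⁻¹)) fun y => ?_
  have h := adicAbs_matMap_inv (isUnit_det_inv A) _ y.2
  rw [Matrix.nonsing_inv_nonsing_inv _ (isUnit_det A)] at h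
  exact h.le

/-- The space `ℤⁿ((B))` of `B`-adic series: the completion of `ℤⁿ(B)` with respect to `d_B`. -/
abbrev AdicSpace (A : ExpandingMatrix n) : Type := Completion (LaurentGroup A)

instance (A : ExpandingMatrix n) : MeasurableSpace (AdicSpace A) := borel _

instance (A : ExpandingMatrix n) : BorelSpace (AdicSpace A) := ⟨rfl⟩

/-- Multiplication by `A` on `ℤⁿ((B))`, the continuous extension of that on `ℤⁿ(B)`. -/
def AdicSpace.mulA (A : ExpandingMatrix n) : AdicSpace A →+ AdicSpace A :=
  (LaurentGroup.mulA A).completion (LaurentGroup.continuous_mulA A)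

theorem LaurentGroup.norm_lt_two (A : ExpandingMatrix n) {y : LaurentGroup A} (h : ‖y‖ < 2) :
    LaurentGroup.val A y ∈ filt (A.1⁻¹) 0 := by
  have hC := isUnit_det_inv A
  by_contra h0
  obtain ⟨j, hj⟩ := exists_mem_filt hC y.2
  obtain ⟨m, hm, h1, h2⟩ := exists_level hC hj h0
  rw [LaurentGroup.norm_def] at h
  have h1' : LaurentGroup.val A y ∈ filt (A.1⁻¹) m := h1
  rw [adicAbs_eq hC h1' h2] at h
  have hb : residueCard (A.1⁻¹) ≠ 1 := by
    intro hb
    rw [← relIndex_filt_succ hC m, AddSubgroup.relIndex_eq_one] at hb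
    exact h2 (hb h1)
  have hb2 : (2 : ℝ) ≤ residueCard (A.1⁻¹) := by
    have := residueCard_ne_zero hC
    exact_mod_cast (by omega : 2 ≤ residueCard (A.1⁻¹))
  have : (residueCard (A.1⁻¹) : ℝ) ^ (1 : ℤ) ≤ (residueCard (A.1⁻¹) : ℝ) ^ (-m) :=
    zpow_le_zpow_right₀ (by linarith) (by omega)
  rw [zpow_one] at this
  linarith

theorem LaurentGroup.totallyBounded (A : ExpandingMatrix n) :
    TotallyBounded {y : LaurentGroup A | LaurentGroup.val A y ∈ filt (A.1⁻¹) 0} := by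
  have hC := isUnit_det_inv A
  rw [Metric.totallyBounded_iff]
  intro ε hε
  obtain ⟨k, hk⟩ : ∃ k : ℕ, ∀ y : LaurentGroup A,
      LaurentGroup.val A y ∈ filt (A.1⁻¹) k → ‖y‖ < ε := by
    rcases eq_or_ne (residueCard (A.1⁻¹)) 1 with hb | hb
    · refine ⟨0, fun y _ => ?_⟩
      rw [LaurentGroup.norm_def]
      rcases adicAbs_cases hC y.2 with ⟨-, e⟩ | ⟨k, h1, h2, -⟩
      · exact lt_of_eq_of_lt e hε
      · rw [← relIndex_filt_succ hC k, AddSubgroup.relIndex_eq_one] at hb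
        exact absurd (hb h1) h2
    · have hb2 : (1 : ℝ) < residueCard (A.1⁻¹) := by
        have := residueCard_ne_zero hC
        exact_mod_cast (by omega : 1 < residueCard (A.1⁻¹))
      obtain ⟨k, hk⟩ := exists_pow_lt_of_lt_one hε (inv_lt_one_of_one_lt₀ hb2)
      refine ⟨k, fun y hy => ?_⟩
      refine (adicAbs_le_of_mem hC hy).trans_lt ?_
      rwa [zpow_neg, zpow_natCast, ← inv_pow]
  have hfin : Finite (filt (A.1⁻¹) 0 ⧸ (filt (A.1⁻¹) k).addSubgroupOf (filt (A.1⁻¹) 0)) :=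
    @AddSubgroup.finite_quotient_of_finiteIndex _ _ _ ⟨relIndex_filt_ne_zero hC k⟩
  let f : (filt (A.1⁻¹) 0 ⧸ (filt (A.1⁻¹) k).addSubgroupOf (filt (A.1⁻¹) 0)) →
      LaurentGroup A := fun q => ⟨q.out.1, filt_le_laurent hC 0 q.out.2⟩
  refine ⟨Set.range f, Set.finite_range f, fun y hy => ?_⟩
  let y' : filt (A.1⁻¹) 0 := ⟨LaurentGroup.val A y, hy⟩
  simp only [Set.mem_iUnion]
  refine ⟨f (QuotientAddGroup.mk y'), ⟨_, rfl⟩, ?_⟩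
  rw [Metric.mem_ball, dist_comm, dist_eq_norm, ← norm_neg, neg_sub, sub_eq_neg_add]
  apply hk
  have h := QuotientAddGroup.eq.1 (QuotientAddGroup.out_eq' (QuotientAddGroup.mk y' :
    filt (A.1⁻¹) 0 ⧸ (filt (A.1⁻¹) k).addSubgroupOf (filt (A.1⁻¹) 0)))
  exact h

theorem AdicSpace.isCompact_closedBall (A : ExpandingMatrix n) :
    IsCompact (Metric.closedBall (0 : AdicSpace A) 1) := by
  have h1 : TotallyBounded (closure ((fun y : LaurentGroup A => (y : AdicSpace A)) ''
      {y : LaurentGroup A | LaurentGroup.val A y ∈ filt (A.1⁻¹) 0})) :=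
    ((LaurentGroup.totallyBounded A).image (Completion.uniformContinuous_coe _)).closure
  refine (h1.subset ?_).isCompact_of_isClosed Metric.isClosed_closedBall
  intro x hx
  rw [mem_closedBall_zero_iff] at hx
  rw [Metric.mem_closure_iff]
  intro ε hε
  obtain ⟨z, ⟨y, rfl⟩, hz⟩ := Metric.mem_closure_iff.1
    (Completion.denseRange_coe (α := LaurentGroup A) x) (min ε 1) (by positivity)
  refine ⟨_, ⟨y, ?_, rfl⟩, hz.trans_le (min_le_left _ _)⟩
  apply LaurentGroup.norm_lt_two
  rw [← Completion.norm_coe]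
  have h2 : ‖(y : AdicSpace A)‖ ≤ ‖x‖ + dist x (y : AdicSpace A) := by
    have h := dist_triangle_left (y : AdicSpace A) 0 x
    rw [dist_zero_right, dist_zero_right, add_comm] at h
    exact h
  have h3 := hz.trans_le (min_le_right _ _)
  linarith

/-- `ℤⁿ[[B]] = {y | ν(y) ≥ 0}`, the closed unit ball of `ℤⁿ((B))`, as a compact set with nonempty
interior. -/
def AdicSpace.unitBall (A : ExpandingMatrix n) :
    TopologicalSpace.PositiveCompacts (AdicSpace A) where
  carrier := Metric.closedBall 0 1
  isCompact' := AdicSpace.isCompact_closedBall A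
  interior_nonempty' :=
    ⟨0, interior_mono Metric.ball_subset_closedBall
      (by rw [Metric.isOpen_ball.interior_eq]; exact Metric.mem_ball_self one_pos)⟩

/-- The Haar measure `μ_B` on `ℤⁿ((B))` normalized by `μ_B(ℤⁿ[[B]]) = 1`. -/
def AdicSpace.haar (A : ExpandingMatrix n) : Measure (AdicSpace A) :=
  Measure.addHaarMeasure (AdicSpace.unitBall A)

/-! ### The representation space and rational self-affine tiles -/

/-- The representation space `𝕂_A = ℝⁿ × ℤⁿ((B))`, with the maximum metric. -/
abbrev RepSpace (A : ExpandingMatrix n) : Type := EuclideanSpace ℝ (Fin n) × AdicSpace A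

/-- The measure `μ = λ × μ_B` on `𝕂_A`. -/
def RepSpace.measure (A : ExpandingMatrix n) : Measure (RepSpace A) :=
  (volume : Measure (EuclideanSpace ℝ (Fin n))).prod (AdicSpace.haar A)

/-- Multiplication by `A` on `𝕂_A`. -/
def RepSpace.mulA (A : ExpandingMatrix n) (z : RepSpace A) : RepSpace A :=
  (WithLp.toLp 2 ((A.1.map (algebraMap ℚ ℝ)).mulVec (WithLp.ofLp z.1)), AdicSpace.mulA A z.2)

/-- The diagonal embedding `φ(x) = (x, x)` of `ℤⁿ(B)` into `𝕂_A`. -/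
def diagonal (A : ExpandingMatrix n) (x : LaurentGroup A) : RepSpace A :=
  (WithLp.toLp 2 fun i => (LaurentGroup.val A x i : ℝ), (x : AdicSpace A))

/-- The inclusion `ℤⁿ[A] → ℤⁿ(B)`. -/
def polyToLaurent (A : ExpandingMatrix n) : polyModule A.1 →+ LaurentGroup A :=
  AddSubgroup.inclusion (by
    have h := polyModule_inv_le (isUnit_det_inv A)
    rwa [Matrix.nonsing_inv_nonsing_inv _ (isUnit_det A)] at h)

/-- `(A, D)` is a digit system: the digit set `D ⊆ ℤⁿ[A]` has as many elements as
`ℤⁿ[A] / A ℤⁿ[A]`. -/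
def IsDigitSystem (A : ExpandingMatrix n) (D : Finset (polyModule A.1)) : Prop :=
  D.card = residueCard A.1

/-- `F` is a nonempty compact solution of the set equation `A F = ⋃_{d ∈ D} (F + φ(d))`. -/
structure IsSelfAffine (A : ExpandingMatrix n) (D : Finset (polyModule A.1))
    (F : Set (RepSpace A)) : Prop where
  nonempty : F.Nonempty
  isCompact : IsCompact F
  setEquation : RepSpace.mulA A '' F =
    ⋃ d ∈ D, (fun z => z + diagonal A (polyToLaurent A d)) '' F

end RationalTile

end

noncomputable section

namespace RationalTile

open MeasureTheory UniformSpace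
open Filter Topology Set
open scoped ENNReal NNReal

/-! ### Iterated function systems of an expanding automorphism -/

section Attractor

variable {K ι : Type*} [NormedAddCommGroup K] (T : K ≃ₜ+ K) (t : ι → K) {s : ℕ → ℝ}

/-! Multiplication by $A$ is an automorphism $T$ of the locally compact group $\mathbb{K}_A$, and
$T^{-k}$ contracts with summable factors: on $\mathbb{R}^n$ by Gelfand's formula, on the adic factor
by at least $1/2$ per step. The set equation says that $\mathcal{F}$ is the attractor of the
contractions $x\mapsto T^{-1}(x+\varphi(d))$. Hence $\mathcal{F}$ is the compact set of all sums
$\sum_k T^{-k-1}\varphi(d_k)$, and it is unique (`eq_range_codingMap`).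

Two arithmetic facts feed the measure theory. First, $\Lambda=\varphi(\mathbb{Z}^n[A])$ is
$T$-invariant and meets every ball in a finite set (`finite_range_diagonalHom_inter`), because
elements of $\mathbb{Z}^n[A]$ of bounded adic size have bounded denominators. Second,
$|\mathbb{Z}^n[A]/A\mathbb{Z}^n[A]|=|\det A|\cdot b$ (`residueCard_eq_abs_det_mul`), so $T$
multiplies $\mu$ by at least $|\mathcal{D}|$ (`residueCard_le_addHaarChar`).

(i)⇒(ii): translation is continuous in measure, so if $\mu(\mathcal{F})>0$, then $\mathcal{F}$
almost fills some tiny set $x+T^{-k}V$ with $V$ a fixed ball. Magnified by $T^k$, this says that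
translates of $\mathcal{F}$ by elements of $\Lambda$ almost fill $f+V$ for some $f\in\mathcal{F}$.
The translates come from one finite collection for all $k$, so in the limit a ball lies in a finite
union of copies of $\mathcal{F}$, and $\mathcal{F}$ has an interior point.

(ii)⇒(iii): the closure of the interior is stable under the contractions, so it is all of
$\mathcal{F}$. For large $k$ one of the $|\mathcal{D}|^k$ copies of $\mathcal{F}$ making up
$T^k\mathcal{F}$ lies in its interior, so $\partial(T^k\mathcal{F})$ is covered by
$|\mathcal{D}|^k-1$ copies of $\partial\mathcal{F}$. Its measure is at least
$|\mathcal{D}|^k\mu(\partial\mathcal{F})$, which forces $\mu(\partial\mathcal{F})=0$.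

(iii)⇒(i): nonempty open sets have positive Haar measure. -/

/-- The iterates of `T⁻¹` contract with summable factors `s`. -/
def ContractsWith (s : ℕ → ℝ) : Prop :=
  Summable s ∧ ∀ k x, ‖T.symm^[k] x‖ ≤ s k * ‖x‖

theorem symm_iterate_add (k : ℕ) (x y : K) :
    T.symm^[k] (x + y) = T.symm^[k] x + T.symm^[k] y :=
  iterate_map_add T.symm k x y

theorem ContractsWith.tendsto_of_bounded {T : K ≃ₜ+ K} (h : ContractsWith T s) {x : ℕ → K} {R : ℝ}
    (hx : ∀ k, ‖x k‖ ≤ R) : Tendsto (fun k => T.symm^[k] (x k)) atTop (𝓝 0) := by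
  have h0 : Tendsto (fun k => |s k| * R) atTop (𝓝 0) := by
    simpa using h.1.tendsto_atTop_zero.abs.mul_const R
  refine squeeze_zero_norm (fun k => (h.2 k (x k)).trans ?_) h0
  exact mul_le_mul (le_abs_self _) (hx k) (norm_nonneg _) (abs_nonneg _)

/-- The point with address `d` of the attractor. -/
def codingMap (d : ℕ → ι) : K := ∑' k, T.symm^[k + 1] (t (d k))

variable {T}

theorem symm_add_mem {F : Set K} (hF : T '' F = ⋃ i, (fun x => x + t i) '' F) (i : ι) {x : K}
    (hx : x ∈ F) : T.symm (x + t i) ∈ F := by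
  have : x + t i ∈ T '' F := hF ▸ mem_iUnion.2 ⟨i, x, hx, rfl⟩
  obtain ⟨y, hy, e⟩ := this
  rwa [← e, ContinuousAddEquiv.symm_apply_apply]

variable [Finite ι]

theorem ContractsWith.summable_coding (h : ContractsWith T s) :
    ∃ u : ℕ → ℝ, Summable u ∧ ∀ k i, ‖T.symm^[k + 1] (t i)‖ ≤ u k := by
  obtain ⟨R, hR⟩ := (Set.finite_range fun i => ‖t i‖).bddAbove
  refine ⟨fun k => |s (k + 1)| * R, ?_, fun k i => (h.2 _ _).trans ?_⟩
  · exact ((summable_nat_add_iff 1).2 h.1.abs).mul_right R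
  · exact mul_le_mul (le_abs_self _) (hR ⟨i, rfl⟩) (norm_nonneg _) (abs_nonneg _)

variable [CompleteSpace K]

theorem hasSum_codingMap (h : ContractsWith T s) (d : ℕ → ι) :
    HasSum (fun k => T.symm^[k + 1] (t (d k))) (codingMap T t d) := by
  obtain ⟨u, hu, hle⟩ := h.summable_coding t
  exact (Summable.of_norm_bounded hu fun k => hle k (d k)).hasSum

/-- The address space is a product of finite discrete spaces, hence compact, and the series
converges uniformly in the address. -/
theorem isCompact_range_codingMap (h : ContractsWith T s) :
    IsCompact (Set.range (codingMap T t)) := by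
  let _ : TopologicalSpace ι := ⊥
  have _ : DiscreteTopology ι := ⟨rfl⟩
  obtain ⟨u, hu, hle⟩ := h.summable_coding t
  refine isCompact_range (continuous_tsum (fun k => ?_) hu fun k d => hle k (d k))
  exact (T.symm.continuous.iterate (k + 1)).comp (continuous_of_discreteTopology.comp
    (continuous_apply k))

theorem map_codingMap (h : ContractsWith T s) (d : ℕ → ι) :
    T (codingMap T t d) = codingMap T t (fun k => d (k + 1)) + t (d 0) := by
  have h1 := (hasSum_codingMap t h d).map T T.continuous
  have h2 : (⇑T ∘ fun k => T.symm^[k + 1] (t (d k))) = fun k => T.symm^[k] (t (d k)) := by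
    funext k
    simp [Function.iterate_succ_apply']
  rw [h2] at h1
  have h3 := (hasSum_nat_add_iff' 1).2 h1
  have h4 := h3.unique (hasSum_codingMap t h fun k => d (k + 1))
  simp only [Finset.range_one, Finset.sum_singleton, Function.iterate_zero, id] at h4
  rw [← h4]
  abel

theorem image_range_codingMap (h : ContractsWith T s) :
    T '' Set.range (codingMap T t) = ⋃ i, (fun x => x + t i) '' Set.range (codingMap T t) := by
  ext x
  simp only [mem_image, mem_range, mem_iUnion, exists_exists_eq_and]
  constructor
  · rintro ⟨d, rfl⟩
    exact ⟨d 0, _, (map_codingMap t h d).symm⟩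
  · rintro ⟨i, d, rfl⟩
    refine ⟨fun k => Nat.casesOn k i d, ?_⟩
    rw [map_codingMap t h]
    rfl

/-- A nonempty closed set that is stable under the inverse branches contains the attractor. -/
theorem range_codingMap_subset (h : ContractsWith T s) {G : Set K} (hG : IsClosed G)
    (hne : G.Nonempty) (hstab : ∀ i, ∀ g ∈ G, T.symm (g + t i) ∈ G) :
    Set.range (codingMap T t) ⊆ G := by
  rintro _ ⟨d, rfl⟩
  obtain ⟨g, hg⟩ := hne
  -- Composing the first `m` inverse branches of the address and applying them to `g` gives the
  -- partial sum plus a vanishing remainder.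
  have key : ∀ m (d : ℕ → ι),
      (∑ k ∈ Finset.range m, T.symm^[k + 1] (t (d k))) + T.symm^[m] g ∈ G := by
    intro m
    induction m with
    | zero => intro d; simpa using hg
    | succ m ih =>
      intro d
      have := hstab (d 0) _ (ih fun k => d (k + 1))
      convert this using 1
      rw [Finset.sum_range_succ', map_add, map_add, map_sum]
      simp only [Function.iterate_succ_apply', Function.iterate_zero, id]
      abel
  have hlim := (hasSum_codingMap t h d).tendsto_sum_nat.add
    (h.tendsto_of_bounded (x := fun _ => g) fun _ => le_rfl)
  rw [add_zero] at hlim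
  exact hG.mem_of_tendsto hlim (Eventually.of_forall fun m => key m d)

/-- A bounded set that is covered by its images under the inverse branches lies in the attractor. -/
theorem subset_range_codingMap (h : ContractsWith T s) {G : Set K} (hG : Bornology.IsBounded G)
    (hcov : ∀ g ∈ G, ∃ i, T g - t i ∈ G) : G ⊆ Set.range (codingMap T t) := by
  intro g hg
  choose i hi using fun x : G => hcov x x.2
  -- Digit expansion: repeatedly apply `T` and subtract a digit that keeps the point in `G`.
  -- Boundedness of the orbit kills the remainder.
  let step : G → G := fun x => ⟨T x - t (i x), hi x⟩
  let x : ℕ → G := fun k => step^[k] ⟨g, hg⟩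
  refine ⟨fun k => i (x k), ?_⟩
  have key : ∀ m, (∑ k ∈ Finset.range m, T.symm^[k + 1] (t (i (x k)))) + T.symm^[m] (x m) = g := by
    intro m
    induction m with
    | zero => simp [x]
    | succ m ih =>
      have hx : (x (m + 1) : K) = T (x m) - t (i (x m)) := by
        simp only [x, Function.iterate_succ_apply', step]
      have : T.symm^[m + 1] (t (i (x m))) + T.symm^[m + 1] (x (m + 1) : K)
          = T.symm^[m] (x m) := by
        rw [← symm_iterate_add, hx, add_sub_cancel, Function.iterate_succ_apply,
          ContinuousAddEquiv.symm_apply_apply]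
      rw [Finset.sum_range_succ, add_assoc, this, ih]
  obtain ⟨R, hR⟩ := hG.exists_norm_le
  have hlim := (hasSum_codingMap t h fun k => i (x k)).tendsto_sum_nat.add
    (h.tendsto_of_bounded (x := fun m => (x m : K)) fun m => hR _ (x m).2)
  rw [add_zero] at hlim
  exact tendsto_nhds_unique hlim (tendsto_const_nhds.congr fun m => (key m).symm)

theorem eq_range_codingMap (h : ContractsWith T s) {F : Set K} (hc : IsCompact F)
    (hne : F.Nonempty) (hF : T '' F = ⋃ i, (fun x => x + t i) '' F) :
    F = Set.range (codingMap T t) := by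
  refine Subset.antisymm (subset_range_codingMap t h hc.isBounded fun g hg => ?_)
    (range_codingMap_subset t h hc.isClosed hne fun i g hg => symm_add_mem t hF i hg)
  have : T g ∈ T '' F := ⟨g, hg, rfl⟩
  rw [hF, mem_iUnion] at this
  obtain ⟨i, y, hy, e⟩ := this
  refine ⟨i, ?_⟩
  have e' : y + t i = T g := e
  rwa [← e', add_sub_cancel_right]

/-- If the attractor has an interior point then it is the closure of its interior. -/
theorem closure_interior_eq (h : ContractsWith T s) {F : Set K} (hc : IsCompact F)
    (hF : T '' F = ⋃ i, (fun x => x + t i) '' F) (hi : (interior F).Nonempty) :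
    F = closure (interior F) := by
  refine Subset.antisymm ?_ (closure_minimal interior_subset hc.isClosed)
  conv_lhs => rw [eq_range_codingMap t h hc (hi.mono interior_subset) hF]
  refine range_codingMap_subset t h isClosed_closure hi.closure fun i g hg => ?_
  let e : K ≃ₜ K := (Homeomorph.addRight (t i)).trans T.symm.toHomeomorph
  have he : ∀ x, e x = T.symm (x + t i) := fun x => rfl
  -- Each inverse branch is a homeomorphism mapping `F` into itself, so it preserves the interior
  -- and then its closure.
  have h1 : e '' interior F ⊆ interior F := by
    rw [e.image_interior]
    refine interior_mono ?_
    rintro _ ⟨x, hx, rfl⟩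
    exact symm_add_mem t hF i hx
  have h2 : e g ∈ e '' closure (interior F) := ⟨g, hg, rfl⟩
  rw [e.image_closure] at h2
  exact closure_mono h1 h2

end Attractor

/-! ### Haar measure: positive measure gives interior, interior gives a null boundary -/

section Measure

/-- A finite form of Baire's theorem: adding a closed set without interior creates no interior
points. -/
theorem interior_biUnion_translates_eq_empty {K : Type*} [NormedAddCommGroup K] {F : Set K}
    (hF : IsClosed F) (hi : interior F = ∅) (S : Finset K) : interior (⋃ a ∈ S, (fun x => x + a) '' F) = ∅ := by
  classical
  induction S using Finset.induction_on with
  | empty => simp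
  | insert a S _ ih =>
    rw [Finset.set_biUnion_insert, interior_union_isClosed_of_interior_empty _ ih]
    · exact ((Homeomorph.addRight a).image_interior F).symm.trans (by rw [hi, image_empty])
    · exact (Homeomorph.addRight a).isClosedMap F hF

variable {K ι : Type*} [NormedAddCommGroup K] [LocallyCompactSpace K] [MeasurableSpace K]
  [BorelSpace K]

/-- Iterating the set equation expresses $T^kF$ through translates indexed by words of length $k$.
Counting words rather than distinct translates gives exactly $|\iota|^k$ pieces. -/
theorem exists_iterate (T : K ≃ₜ+ K) (t : ι → K) {Λ : AddSubgroup K} (hΛ : ∀ x ∈ Λ, T x ∈ Λ)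
    (ht : ∀ i, t i ∈ Λ) {F : Set K} (hF : T '' F = ⋃ i, (fun x => x + t i) '' F) (k : ℕ) :
    ∃ (U : K ≃ₜ+ K) (q : (Fin k → ι) → K), (∀ x, U.symm x = T.symm^[k] x) ∧
      addEquivAddHaarChar U = addEquivAddHaarChar T ^ k ∧ (∀ w, q w ∈ Λ) ∧
      U '' F = ⋃ w, (fun x => x + q w) '' F := by
  induction k with
  | zero =>
    refine ⟨ContinuousAddEquiv.refl K, fun _ => 0, fun x => rfl, by simp, fun _ => zero_mem _, ?_⟩
    rw [iUnion_const]
    simp [ContinuousAddEquiv.refl]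
  | succ k ih =>
    obtain ⟨U, q, h1, h2, h3, h4⟩ := ih
    refine ⟨U.trans T, fun w => T (q (Fin.tail w)) + t (w 0), fun x => ?_, ?_, fun w => ?_, ?_⟩
    · rw [Function.iterate_succ_apply, ← h1]
      rfl
    · rw [addEquivAddHaarChar_trans, h2, pow_succ]
    · exact add_mem (hΛ _ (h3 _)) (ht _)
    · rw [ContinuousAddEquiv.coe_trans, image_comp, h4]
      ext x
      simp only [mem_image, mem_iUnion]
      constructor
      · rintro ⟨_, ⟨w, y, hy, rfl⟩, rfl⟩
        have : T y ∈ T '' F := ⟨y, hy, rfl⟩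
        rw [hF, mem_iUnion] at this
        obtain ⟨i, z, hz, e⟩ := this
        refine ⟨Fin.cons i w, z, hz, ?_⟩
        have e' : z + t i = T y := e
        rw [Fin.tail_cons, Fin.cons_zero, map_add, ← e']
        abel
      · rintro ⟨w, z, hz, rfl⟩
        have : z + t (w 0) ∈ T '' F := hF ▸ mem_iUnion.2 ⟨_, z, hz, rfl⟩
        obtain ⟨y, hy, e⟩ := this
        refine ⟨_, ⟨Fin.tail w, y, hy, rfl⟩, ?_⟩
        rw [map_add, e]
        abel

variable [SecondCountableTopology K] (μ : Measure K) [μ.IsAddHaarMeasure]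

theorem measure_image_equiv (U : K ≃ₜ+ K) (E : Set K) :
    μ (U '' E) = addEquivAddHaarChar U • μ E := by
  rw [← addEquivAddHaarChar_smul_preimage μ U, preimage_image_eq _ U.injective]

variable {T : K ≃ₜ+ K} {t : ι → K} {s : ℕ → ℝ}

/-- One whole piece of $T^kF$ lies in its interior, so $|\iota|^k-1$ copies of the boundary cover a
set of measure at least $|\iota|^k\mu(\partial F)$. -/
theorem measure_frontier_eq_zero [Fintype ι] (h : ContractsWith T s) {F : Set K} (hc : IsCompact F)
    (hF : T '' F = ⋃ i, (fun x => x + t i) '' F) (hi : (interior F).Nonempty)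
    (hcard : (Fintype.card ι : ℝ≥0) ≤ addEquivAddHaarChar T) : μ (frontier F) = 0 := by
  classical
  obtain ⟨x, hx⟩ := hi
  obtain ⟨r, hr, hball⟩ := Metric.isOpen_iff.1 isOpen_interior x hx
  obtain ⟨R, hR⟩ := hc.isBounded.exists_norm_le
  -- A piece has diameter at most $2R$; this `k` makes $T^{-k}$ shrink it below the radius of the
  -- ball inside `F`.
  obtain ⟨k, hk⟩ : ∃ k, |s k| * (2 * R) < r := by
    have := h.1.tendsto_atTop_zero.abs.mul_const (2 * R)
    rw [abs_zero, zero_mul] at this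
    exact (this.eventually (gt_mem_nhds hr)).exists
  obtain ⟨U, q, hU, hchar, -, hUF⟩ := exists_iterate T t (Λ := ⊤) (fun _ _ => trivial)
    (fun _ => trivial) hF k
  obtain ⟨w₀, f₀, hf₀, hw₀⟩ : ∃ w, ∃ f ∈ F, f + q w = U x := by
    have : U x ∈ U '' F := ⟨x, interior_subset hx, rfl⟩
    rw [hUF, mem_iUnion] at this
    exact this
  -- The piece containing `U x` is pulled back by $U^{-1}$ into the ball around `x`, so it is
  -- interior to `U '' F`.
  have hsub : (fun x => x + q w₀) '' F ⊆ interior (U '' F) := by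
    have e : interior (U '' F) = U '' interior F := (U.toHomeomorph.image_interior F).symm
    rw [e]
    rintro _ ⟨f, hf, rfl⟩
    refine ⟨U.symm (f + q w₀), hball ?_, U.apply_symm_apply _⟩
    have e2 : U.symm (f + q w₀) - x = T.symm^[k] (f - f₀) := by
      rw [← hU]
      conv_lhs => rw [← U.symm_apply_apply x, ← map_sub, ← hw₀, add_sub_add_right_eq_sub]
    rw [Metric.mem_ball, dist_eq_norm, e2]
    refine ((h.2 _ _).trans ?_).trans_lt hk
    refine mul_le_mul (le_abs_self _) ((norm_sub_le _ _).trans ?_) (norm_nonneg _) (abs_nonneg _)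
    linarith [hR f hf, hR f₀ hf₀]
  have hfr : U '' frontier F ⊆ ⋃ w ∈ Finset.univ.erase w₀, (fun x => x + q w) '' frontier F := by
    have e : U '' frontier F = frontier (U '' F) := U.toHomeomorph.image_frontier F
    have hcl : IsClosed (U '' F) := (hc.image U.continuous).isClosed
    rw [e, hcl.frontier_eq]
    rintro y ⟨hy, hy'⟩
    rw [hUF, mem_iUnion] at hy
    obtain ⟨w, f, hf, rfl⟩ := hy
    refine mem_biUnion (x := w) ?_ ⟨f, ?_, rfl⟩
    · simp only [Finset.mem_erase, Finset.mem_univ, and_true, Finset.mem_coe]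
      rintro rfl
      exact hy' (hsub ⟨f, hf, rfl⟩)
    · rw [hc.isClosed.frontier_eq]
      refine ⟨hf, fun hf' => hy' ?_⟩
      refine interior_mono (hUF ▸ subset_iUnion (fun w => (fun x => x + q w) '' F) w) ?_
      have := (Homeomorph.addRight (q w)).image_interior F
      exact this ▸ ⟨f, hf', rfl⟩
  have hle := (measure_mono hfr).trans (measure_biUnion_finset_le (μ := μ) _ _)
  have hfin : μ (frontier F) ≠ ∞ :=
    (hc.of_isClosed_subset isClosed_frontier hc.isClosed.frontier_subset).measure_lt_top.ne
  simp only [image_add_right, measure_preimage_add_right, Finset.sum_const, Finset.card_erase_of_mem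
    (Finset.mem_univ w₀), Finset.card_univ, measure_image_equiv, hchar,
    ENNReal.smul_def, smul_eq_mul, nsmul_eq_mul] at hle
  lift μ (frontier F) to ℝ≥0 using hfin with m
  norm_cast at hle ⊢
  by_contra hm
  have hm' : 0 < m := pos_iff_ne_zero.2 hm
  rw [mul_le_mul_iff_left₀ hm', Fintype.card_fun, Fintype.card_fin] at hle
  have h1 : (Fintype.card ι : ℝ≥0) ^ k ≤ addEquivAddHaarChar T ^ k := by gcongr
  have h2 : 0 < Fintype.card ι ^ k := by
    -- Positivity of the number of words matters: the subtraction of `1` is truncated.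
    have : Nonempty (Fin k → ι) := ⟨w₀⟩
    have := Fintype.card_pos (α := Fin k → ι)
    rwa [Fintype.card_fun, Fintype.card_fin] at this
  have h3 := h1.trans hle
  norm_cast at h3
  omega

/-- By outer regularity `F` lies in an open set of barely larger measure, which by compactness also
contains all small translates of `F`. -/
theorem exists_measure_image_add_diff_le {F : Set K} (hc : IsCompact F) {ε : ℝ≥0∞} (hε : ε ≠ 0) :
    ∃ r > 0, ∀ v, ‖v‖ < r → μ ((fun x => x + v) '' F \ F) ≤ ε := by
  obtain ⟨O, hFO, hO, hlt⟩ := hc.exists_isOpen_lt_add (μ := μ) hε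
  obtain ⟨r, hr, hsub⟩ := hc.exists_thickening_subset_open hO hFO
  refine ⟨r, hr, fun v hv => ?_⟩
  have h1 : (fun x => x + v) '' F \ F ⊆ O \ F := by
    rintro _ ⟨⟨x, hx, rfl⟩, hx'⟩
    refine ⟨hsub (Metric.mem_thickening_iff.2 ⟨x, hx, ?_⟩), hx'⟩
    rw [dist_eq_norm]
    simpa using hv
  refine (measure_mono h1).trans ?_
  rw [measure_sdiff hFO hc.measurableSet.nullMeasurableSet hc.measure_lt_top.ne]
  exact tsub_le_iff_left.2 hlt.le

/-- A substitute for Lebesgue density: by Fubini, the integral over $x\in F$ of the part of $x+W$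
missed by $F$ equals $\int_W\mu((F+v)\setminus F)\,dv\le\varepsilon\mu(W)$, and some $x\in F$ does
no worse than the average. -/
theorem exists_measure_translate_le {F W : Set K} (hF : MeasurableSet F) (hW : MeasurableSet W)
    (h0 : μ F ≠ 0) (hfin : μ F ≠ ∞) {ε : ℝ≥0∞}
    (hε : ∀ v ∈ W, μ ((fun x => x + v) '' F \ F) ≤ ε) :
    ∃ x ∈ F, μ {v | v ∈ W ∧ x + v ∉ F} ≤ ε * μ W / μ F := by
  let Z : Set (K × K) := {p | p.1 ∈ F ∧ p.2 ∈ W ∧ p.1 + p.2 ∉ F}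
  have hZ : MeasurableSet Z := by
    refine (measurable_fst hF).inter ((measurable_snd hW).inter ?_)
    exact (measurable_fst.add measurable_snd) hF.compl
  have hle : (μ.prod μ) Z ≤ ε * μ W := by
    rw [Measure.prod_apply_symm hZ]
    calc ∫⁻ v, μ ((fun x => (x, v)) ⁻¹' Z) ∂μ ≤ ∫⁻ v, W.indicator (fun _ => ε) v ∂μ := by
          refine lintegral_mono fun v => ?_
          by_cases hv : v ∈ W
          · rw [indicator_of_mem hv]
            refine le_trans ?_ (hε v hv)
            rw [← measure_preimage_add_right μ v (_ \ F)]
            refine measure_mono ?_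
            rintro x ⟨h1, -, h3⟩
            exact ⟨⟨x, h1, rfl⟩, h3⟩
          · rw [indicator_of_notMem hv, nonpos_iff_eq_zero]
            convert! measure_empty (μ := μ)
            ext x
            simp [Z, hv]
      _ = ε * μ W := by rw [lintegral_indicator hW, setLIntegral_const]
  have hge : ∫⁻ x in F, μ {v | v ∈ W ∧ x + v ∉ F} ∂μ ≤ (μ.prod μ) Z := by
    rw [Measure.prod_apply hZ, ← lintegral_indicator hF]
    refine lintegral_mono fun x => ?_
    by_cases hx : x ∈ F
    · rw [indicator_of_mem hx]
      exact measure_mono fun v hv => ⟨hx, hv⟩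
    · rw [indicator_of_notMem hx]
      exact zero_le
  obtain ⟨x, hx, hxle⟩ := exists_le_setLAverage h0 hfin (f := fun x => μ {v | v ∈ W ∧ x + v ∉ F})
    (by
      have := (measurable_measure_prodMk_left (ν := μ)
        (((measurable_snd hW).inter ((measurable_fst.add measurable_snd) hF.compl)) :
          MeasurableSet (Prod.snd ⁻¹' W ∩ (fun p : K × K => p.1 + p.2) ⁻¹' Fᶜ)))
      exact this.aemeasurable)
  refine ⟨x, hx, hxle.trans ?_⟩
  rw [setLAverage_eq]
  gcongr
  exact hge.trans hle

/-- The magnification step: a small window that `F` almost fills is blown up by $T^k$ to a ball of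
fixed radius. There `F` is replaced by translates by $\Lambda$, seen relative to the piece
containing the magnified centre. -/
theorem exists_measure_ball_diff_le [Finite ι] (h : ContractsWith T s) {Λ : AddSubgroup K}
    (hΛ : ∀ x ∈ Λ, T x ∈ Λ) (ht : ∀ i, t i ∈ Λ) {F : Set K} (hc : IsCompact F)
    (hF : T '' F = ⋃ i, (fun x => x + t i) '' F) (h0 : μ F ≠ 0) {R ρ : ℝ}
    (hR : ∀ x ∈ F, ‖x‖ ≤ R) (hρ : 0 < ρ) (hfin : μ (Metric.ball 0 ρ) ≠ ∞) {G : Set K}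
    (hG : ∀ x ∈ Λ, ‖x‖ ≤ 2 * R + ρ → (fun y => y + x) '' F ⊆ G) {δ : ℝ≥0∞} (hδ : δ ≠ 0) :
    ∃ f ∈ F, μ {v | v ∈ Metric.ball 0 ρ ∧ f + v ∉ G} ≤ δ := by
  set V := Metric.ball (0 : K) ρ with hV
  have hV0 : μ V ≠ 0 := (Metric.measure_ball_pos μ 0 hρ).ne'
  have hFfin : μ F ≠ ∞ := hc.measure_lt_top.ne
  -- Chosen so that the averaged defect `ε * μ W / μ F` becomes exactly `δ` after scaling by `U`,
  -- since `U` carries `W` onto `V`.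
  set ε := δ * μ F / μ V with hε
  have hε0 : ε ≠ 0 := ENNReal.div_ne_zero.2 ⟨mul_ne_zero hδ h0, hfin⟩
  have hεV : ε * μ V / μ F = δ := by
    rw [hε, ENNReal.div_mul_cancel hV0 hfin, ENNReal.mul_div_cancel_right h0 hFfin]
  obtain ⟨r, hr, hsmall⟩ := exists_measure_image_add_diff_le μ hc hε0
  obtain ⟨k, hk⟩ : ∃ k, |s k| * ρ < r := by
    have := h.1.tendsto_atTop_zero.abs.mul_const ρ
    rw [abs_zero, zero_mul] at this
    exact (this.eventually (gt_mem_nhds hr)).exists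
  obtain ⟨U, q, hU, -, hq, hUF⟩ := exists_iterate T t hΛ ht hF k
  let W : Set K := U ⁻¹' V
  have hW : MeasurableSet W := U.continuous.measurable Metric.isOpen_ball.measurableSet
  have hWV : μ V = addEquivAddHaarChar U • μ W := (addEquivAddHaarChar_smul_preimage μ U).symm
  have hWr : ∀ v ∈ W, ‖v‖ < r := by
    intro v hv
    have hv' : ‖U v‖ < ρ := by simpa [W, hV] using hv
    rw [← U.symm_apply_apply v, hU]
    refine ((h.2 _ _).trans ?_).trans_lt hk
    exact mul_le_mul (le_abs_self _) hv'.le (norm_nonneg _) (abs_nonneg _)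
  obtain ⟨x, hx, hxle⟩ := exists_measure_translate_le μ hc.measurableSet hW h0 hFfin
    fun v hv => hsmall v (hWr v hv)
  obtain ⟨w₀, f₀, hf₀, hw₀⟩ : ∃ w, ∃ f ∈ F, f + q w = U x := by
    have : U x ∈ U '' F := ⟨x, hx, rfl⟩
    rw [hUF, mem_iUnion] at this
    exact this
  refine ⟨f₀, hf₀, ?_⟩
  have hsub : {v | v ∈ V ∧ f₀ + v ∉ G} ⊆ U '' {v | v ∈ W ∧ x + v ∉ F} := by
    rintro v ⟨hv, hvG⟩
    refine ⟨U.symm v, ⟨by simpa [W] using hv, fun hxv => hvG ?_⟩, U.apply_symm_apply v⟩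
    have : U (x + U.symm v) ∈ U '' F := ⟨_, hxv, rfl⟩
    rw [hUF, mem_iUnion] at this
    obtain ⟨w, f, hf, e⟩ := this
    have e' : f + q w = f₀ + q w₀ + v := by
      rw [hw₀]
      simpa using e
    -- Two pieces meeting the magnified window differ by $f_0-f+v$, of norm at most $2R+\rho$; hence
    -- the bound in `hG`.
    have e2 : q w - q w₀ = f₀ - f + v := by
      rw [sub_eq_iff_eq_add, ← sub_eq_iff_eq_add'.2 e'.symm]
      abel
    refine hG (q w - q w₀) (sub_mem (hq _) (hq _)) ?_ ⟨f, hf, ?_⟩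
    · rw [e2]
      have hv' : ‖v‖ < ρ := by simpa [hV] using hv
      linarith [norm_add_le (f₀ - f) v, norm_sub_le f₀ f, hR f hf, hR f₀ hf₀]
    · change f + (q w - q w₀) = f₀ + v
      rw [e2]
      abel
  refine (measure_mono hsub).trans ?_
  rw [measure_image_equiv, ENNReal.smul_def, smul_eq_mul]
  refine (mul_le_mul_right hxle _).trans ?_
  rw [← hεV, hWV, ENNReal.smul_def, smul_eq_mul, ← mul_div_assoc, mul_left_comm]

/-- Finiteness of $\Lambda$ in balls makes the covering set `G` a closed finite union independent of
the magnification, so the defect can tend to zero with `G` fixed. -/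
theorem interior_nonempty_of_measure_ne_zero [Finite ι] (h : ContractsWith T s)
    {Λ : AddSubgroup K} (hΛ : ∀ x ∈ Λ, T x ∈ Λ) (hΛfin : ∀ R : ℝ, {x | x ∈ Λ ∧ ‖x‖ ≤ R}.Finite)
    (ht : ∀ i, t i ∈ Λ) {F : Set K} (hc : IsCompact F)
    (hF : T '' F = ⋃ i, (fun x => x + t i) '' F) (h0 : μ F ≠ 0) : (interior F).Nonempty := by
  by_contra hne
  obtain ⟨R, hR⟩ := hc.isBounded.exists_norm_le
  obtain ⟨ρ, hρ, hfin⟩ : ∃ ρ > 0, μ (Metric.ball 0 ρ) ≠ ∞ := by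
    obtain ⟨N, hN, hlt⟩ := μ.finiteAt_nhds (0 : K)
    obtain ⟨ρ, hρ, hsub⟩ := Metric.mem_nhds_iff.1 hN
    exact ⟨ρ, hρ, ((measure_mono hsub).trans_lt hlt).ne⟩
  set S := (hΛfin (2 * R + ρ)).toFinset with hS
  set G := ⋃ a ∈ S, (fun x => x + a) '' F with hG
  have hGc : IsClosed G := by
    refine S.finite_toSet.isClosed_biUnion fun a _ => ?_
    exact (Homeomorph.addRight a).isClosedMap F hc.isClosed
  have key : ∀ m : ℕ, ∃ f ∈ F, μ {v | v ∈ Metric.ball 0 ρ ∧ f + v ∉ G} ≤ (m + 1 : ℝ≥0∞)⁻¹ :=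
    fun m => exists_measure_ball_diff_le μ h hΛ ht hc hF h0 hR hρ hfin
      (fun x hx hxR => subset_biUnion_of_mem (u := fun a => (fun x => x + a) '' F)
        (show x ∈ (S : Set K) by simpa [hS] using ⟨hx, hxR⟩)) (by simp)
  choose f hf hfle using key
  obtain ⟨g, -, φ, hφ, hlim⟩ := hc.tendsto_subseq hf
  have hsub : Metric.ball g ρ ⊆ G := by
    intro y hy
    by_contra hyG
    -- A missed point has a missed neighbourhood. Recentred at `f (φ m)`, this leaves a ball of
    -- radius `η / 2` inside the defect sets for all large `m`, whose measures tend to zero.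
    obtain ⟨η, hη, hball⟩ := Metric.isOpen_iff.1 (Metric.isOpen_ball.inter hGc.isOpen_compl) y
      ⟨hy, hyG⟩
    have h1 : ∀ᶠ m in atTop, μ (Metric.ball 0 (η / 2)) ≤ (φ m + 1 : ℝ≥0∞)⁻¹ := by
      obtain ⟨hy1, -⟩ := hball (Metric.mem_ball_self hη)
      have h2 := Metric.tendsto_nhds.1 hlim (η / 2) (by positivity)
      filter_upwards [h2] with m hm
      refine le_trans ?_ (hfle (φ m))
      rw [← measure_preimage_add_right μ (-(y - g))]
      refine measure_mono fun v hv => ?_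
      have hv' : ‖v - (y - g)‖ < η / 2 := by
        rw [sub_eq_add_neg]
        exact mem_ball_zero_iff.1 hv
      refine ⟨?_, ?_⟩
      · have : v + g ∈ Metric.ball y η := by
          rw [Metric.mem_ball, dist_eq_norm]
          have : v + g - y = v - (y - g) := by abel
          rw [this]
          linarith
        have := (hball this).1
        simpa [dist_eq_norm] using this
      · have : f (φ m) + v ∈ Metric.ball y η := by
          rw [Metric.mem_ball, dist_eq_norm]
          have e : f (φ m) + v - y = (f (φ m) - g) + (v - (y - g)) := by abel
          rw [e]
          rw [dist_eq_norm] at hm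
          have hm' : ‖f (φ m) - g‖ < η / 2 := hm
          linarith [norm_add_le (f (φ m) - g) (v - (y - g))]
        exact (hball this).2
    have h3 : Tendsto (fun m => (φ m + 1 : ℝ≥0∞)⁻¹) atTop (𝓝 0) := by
      have := (ENNReal.tendsto_inv_nat_nhds_zero.comp (tendsto_add_atTop_nat 1)).comp
        hφ.tendsto_atTop
      refine this.congr fun m => ?_
      simp
    have h4 := ge_of_tendsto h3 h1
    exact (Metric.measure_ball_pos μ 0 (half_pos hη)).ne' (nonpos_iff_eq_zero.1 h4)
  have hempty := interior_biUnion_translates_eq_empty hc.isClosed (not_nonempty_iff_eq_empty.1 hne) S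
  have : g ∈ interior G :=
    interior_mono hsub (by rw [Metric.isOpen_ball.interior_eq]; exact Metric.mem_ball_self hρ)
  rw [hG, hempty] at this
  exact this

end Measure

/-! ### Discreteness of the digit module -/

section Discrete

open Polynomial

variable {n : ℕ} (C : Matrix (Fin n) (Fin n) ℚ)

/-- Evaluation at `C` of polynomials with coefficients in `ℤⁿ`. -/
def polyEval : (Fin n → ℤ[X]) →+ (Fin n → ℚ) where
  toFun F := ∑ i, (aeval C (F i)).mulVec (Pi.single i 1)
  map_zero' := by simp only [Pi.zero_apply, map_zero, Matrix.zero_mulVec, Finset.sum_const_zero]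
  map_add' F G := by simp only [Pi.add_apply, map_add, Matrix.add_mulVec, Finset.sum_add_distrib]

theorem polyEval_apply (F : Fin n → ℤ[X]) :
    polyEval C F = ∑ i, (aeval C (F i)).mulVec (Pi.single i 1) := rfl

theorem polyEval_smul (p : ℤ[X]) (F : Fin n → ℤ[X]) :
    polyEval C (p • F) = (aeval C p).mulVec (polyEval C F) := by
  simp only [polyEval_apply, Pi.smul_apply, smul_eq_mul, map_mul, Matrix.mulVec_sum,
    Matrix.mulVec_mulVec]

theorem polyEval_C_castVec (u : Fin n → ℤ) :
    polyEval C (fun i => Polynomial.C (u i)) = castVec n u := by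
  rw [polyEval_apply]
  ext j
  simp only [castVec, aeval_C, Finset.sum_apply, Algebra.algebraMap_eq_smul_one,
    AddMonoidHom.compLeft_apply, Function.comp, Matrix.smul_mulVec, Matrix.one_mulVec,
    Pi.smul_apply, Int.coe_castAddHom]
  rw [Finset.sum_eq_single j]
  · simp
  · intro i _ hij
    simp [hij.symm]
  · simp

theorem exists_polyEval_eq {y : Fin n → ℚ} (hy : y ∈ polyModule C) : ∃ F, polyEval C F = y := by
  suffices polyModule C ≤ (polyEval C).range from this hy
  refine iSup_le fun k => ?_
  rintro _ ⟨_, ⟨u, rfl⟩, rfl⟩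
  refine ⟨(X : ℤ[X]) ^ k • fun i => Polynomial.C (u i), ?_⟩
  rw [polyEval_smul, polyEval_C_castVec]
  simp [matMap_apply]

/-- The kernel of evaluation at `C`. -/
def polyKer : Submodule ℤ[X] (Fin n → ℤ[X]) where
  carrier := {F | polyEval C F = 0}
  zero_mem' := map_zero _
  add_mem' {F G} hF hG := by
    have hF' : polyEval C F = 0 := hF
    have hG' : polyEval C G = 0 := hG
    simp [hF', hG']
  smul_mem' p F hF := by
    have hF' : polyEval C F = 0 := hF
    simp [polyEval_smul, hF']

variable {C}

/-- On a generator $C^kC^{-j}u$ multiplication by $C^j$ leaves $C^ku$. Sums are brought to a common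
exponent, the degree excess staying at most $k$. -/
theorem exists_natDegree_le_of_mem_filt (hC : IsUnit C.det) (k : ℕ) {y : Fin n → ℚ}
    (hy : y ∈ filt C⁻¹ (-k : ℤ)) :
    ∃ (m : ℕ) (G : Fin n → ℤ[X]), (∀ i, (G i).natDegree ≤ m + k) ∧
      polyEval C G = (C ^ m).mulVec y := by
  obtain ⟨z, hz, rfl⟩ := hy
  rw [Matrix.zpow_neg (Matrix.isUnit_nonsing_inv_det _ hC), zpow_natCast, Matrix.inv_pow',
    Matrix.nonsing_inv_nonsing_inv _ (by rw [Matrix.det_pow]; exact hC.pow k)]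
  refine AddSubgroup.iSup_induction _ (C := fun z => ∃ (m : ℕ) (G : Fin n → ℤ[X]),
      (∀ i, (G i).natDegree ≤ m + k) ∧ polyEval C G = (C ^ m).mulVec (matMap (C ^ k) z)) hz ?_ ?_ ?_
  · rintro j _ ⟨_, ⟨u, rfl⟩, rfl⟩
    refine ⟨j, (X : ℤ[X]) ^ k • fun i => Polynomial.C (u i), fun i => ?_, ?_⟩
    · refine (natDegree_mul_le).trans ?_
      simp
    · rw [polyEval_smul, polyEval_C_castVec]
      simp only [map_pow, aeval_X, matMap_apply, Matrix.mulVec_mulVec]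
      congr 1
      rw [← mul_assoc, ← pow_add, add_comm, pow_add, Matrix.inv_pow',
        Matrix.mul_nonsing_inv_cancel_right]
      rw [Matrix.det_pow]
      exact hC.pow j
  · exact ⟨0, 0, by simp, by simp⟩
  · rintro x y ⟨m₁, G₁, h₁, e₁⟩ ⟨m₂, G₂, h₂, e₂⟩
    refine ⟨m₁ + m₂, (X : ℤ[X]) ^ m₂ • G₁ + (X : ℤ[X]) ^ m₁ • G₂, fun i => ?_, ?_⟩
    · change ((X : ℤ[X]) ^ m₂ * G₁ i + X ^ m₁ * G₂ i).natDegree ≤ _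
      refine natDegree_add_le_of_degree_le (natDegree_mul_le.trans ?_) (natDegree_mul_le.trans ?_)
      · have := h₁ i
        rw [natDegree_X_pow]
        omega
      · have := h₂ i
        rw [natDegree_X_pow]
        omega
    · rw [map_add, polyEval_smul, polyEval_smul, e₁, e₂, map_add, Matrix.mulVec_add]
      simp only [map_pow, aeval_X, Matrix.mulVec_mulVec, ← pow_add]
      rw [add_comm m₂ m₁]

/-- The elements of `ℤⁿ[C]` with bounded `C⁻¹`-adic absolute value are values of polynomials of
bounded degree. -/
theorem exists_natDegree_bound (hC : IsUnit C.det) (k : ℕ) :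
    ∃ N : ℕ, ∀ y ∈ polyModule C ⊓ filt C⁻¹ (-k : ℤ), ∃ F : Fin n → ℤ[X],
      (∀ i, (F i).natDegree ≤ N) ∧ polyEval C F = y := by
  obtain ⟨r, κ, hκ⟩ := Submodule.fg_iff_exists_fin_generating_family.1
    (IsNoetherian.noetherian (polyKer C))
  let N₀ := ∑ l, ∑ i, (κ l i).natDegree
  have hN₀ : ∀ l i, (κ l i).natDegree ≤ N₀ := fun l i =>
    (Finset.single_le_sum (f := fun i => (κ l i).natDegree) (by simp) (Finset.mem_univ i)).trans
      (Finset.single_le_sum (f := fun l => ∑ i, (κ l i).natDegree) (by simp) (Finset.mem_univ l))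
  refine ⟨max k N₀, fun y ⟨hy, hy'⟩ => ?_⟩
  obtain ⟨F, rfl⟩ := exists_polyEval_eq C hy
  obtain ⟨m, G, hG, hGe⟩ := exists_natDegree_le_of_mem_filt hC k hy'
  have hker : (X : ℤ[X]) ^ m • F - G ∈ polyKer C := by
    change polyEval C _ = 0
    rw [map_sub, polyEval_smul, hGe]
    simp
  rw [← hκ, Submodule.mem_span_range_iff_exists_fun] at hker
  obtain ⟨h, hh⟩ := hker
  have hmon : ((X : ℤ[X]) ^ m).Monic := monic_X_pow m
  -- Subtracting kernel elements keeps the value. With $X^mF=G+\sum h_l\kappa_l$, removing the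
  -- quotients of the $h_l$ by $X^m$ leaves $G$ plus remainders times $\kappa_l$, of degree at most
  -- $m+\max(k,N_0)$. Cancelling $X^m$ gives a bound free of $m$.
  refine ⟨F - ∑ l, (h l /ₘ X ^ m) • κ l, fun i => ?_, ?_⟩
  · have e : (X : ℤ[X]) ^ m • (F - ∑ l, (h l /ₘ X ^ m) • κ l)
        = G + ∑ l, (h l %ₘ X ^ m) • κ l := by
      have : ∑ l, h l • κ l = ∑ l, (h l %ₘ X ^ m) • κ l
          + (X : ℤ[X]) ^ m • ∑ l, (h l /ₘ X ^ m) • κ l := by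
        rw [Finset.smul_sum, ← Finset.sum_add_distrib]
        refine Finset.sum_congr rfl fun l _ => ?_
        rw [smul_smul, ← add_smul, modByMonic_add_div]
      rw [this] at hh
      rw [smul_sub, sub_eq_iff_eq_add, add_assoc, hh]
      abel
    have e' := congr_fun e i
    rcases eq_or_ne ((F - ∑ l, (h l /ₘ X ^ m) • κ l) i) 0 with h0 | h0
    · rw [h0]
      simp
    have hdeg : ((X : ℤ[X]) ^ m * (F - ∑ l, (h l /ₘ X ^ m) • κ l) i).natDegree
        ≤ m + max k N₀ := by
      rw [← smul_eq_mul, ← Pi.smul_apply, e', Pi.add_apply, Finset.sum_apply]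
      refine natDegree_add_le_of_degree_le ((hG i).trans (by omega)) ?_
      refine natDegree_sum_le_of_forall_le _ _ fun l _ => natDegree_mul_le.trans ?_
      have h1 := hN₀ l i
      have h2 : (h l %ₘ X ^ m).natDegree ≤ m := by
        have := natDegree_modByMonic_le (h l) hmon
        rwa [natDegree_X_pow] at this
      omega
    rw [hmon.natDegree_mul' h0, natDegree_X_pow] at hdeg
    omega
  · have h0 : ∀ l, polyEval C (κ l) = 0 := fun l => by
      have : κ l ∈ polyKer C := hκ ▸ Submodule.subset_span ⟨l, rfl⟩
      exact this
    rw [map_sub, map_sum]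
    simp [polyEval_smul, h0]

theorem exists_integer_multiple (M : Matrix (Fin n) (Fin n) ℚ) :
    ∃ c : ℕ, c ≠ 0 ∧ ∀ v ∈ intVectors n, matMap ((c : ℚ) • M) v ∈ intVectors n := by
  obtain ⟨c, hc⟩ := IsLocalization.exist_integer_multiples_of_finite (nonZeroDivisors ℤ)
    (fun p : Fin n × Fin n => M p.1 p.2)
  choose g hg using hc
  refine ⟨(c : ℤ).natAbs, Int.natAbs_ne_zero.2 (nonZeroDivisors.ne_zero c.2), ?_⟩
  rintro _ ⟨v, rfl⟩
  refine ⟨(c : ℤ).sign • (Matrix.of fun i j => g (i, j)).mulVec v, ?_⟩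
  ext i
  simp only [castVec, AddMonoidHom.compLeft_apply, Function.comp, matMap_apply, Matrix.mulVec,
    dotProduct, Matrix.of_apply, Int.coe_castAddHom, Pi.smul_apply, Int.cast_sum, Int.cast_mul,
    smul_eq_mul, Matrix.smul_apply, Finset.mul_sum]
  refine Finset.sum_congr rfl fun j _ => ?_
  have h := hg (i, j)
  simp only [algebraMap_int_eq, eq_intCast, zsmul_eq_mul] at h
  rw [h, ← mul_assoc, ← mul_assoc, ← Int.cast_mul, Int.sign_mul_self, Int.cast_natCast]

theorem natCast_smul_mem {L : AddSubgroup (Fin n → ℚ)} {v : Fin n → ℚ} (hv : v ∈ L) (c : ℕ) :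
    (c : ℚ) • v ∈ L := by
  have := nsmul_mem hv c
  rwa [← Nat.cast_smul_eq_nsmul ℚ] at this

theorem exists_smul_polyEval_mem (C : Matrix (Fin n) (Fin n) ℚ) (N : ℕ) :
    ∃ c : ℕ, c ≠ 0 ∧ ∀ F : Fin n → ℤ[X], (∀ i, (F i).natDegree ≤ N) →
      (c : ℚ) • polyEval C F ∈ intVectors n := by
  choose c hc0 hc using fun k : ℕ => exists_integer_multiple (C ^ k)
  refine ⟨∏ k ∈ Finset.range (N + 1), c k, Finset.prod_ne_zero_iff.2 fun k _ => hc0 k,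
    fun F hF => ?_⟩
  rw [polyEval_apply, Finset.smul_sum]
  refine sum_mem fun i _ => ?_
  have h1 : aeval C (F i) = ∑ k ∈ Finset.range (N + 1), (F i).coeff k • C ^ k := by
    rw [aeval_eq_sum_range' (Nat.lt_succ_of_le (hF i))]
  rw [h1, Matrix.sum_mulVec, Finset.smul_sum]
  refine sum_mem fun k hk => ?_
  rw [← Finset.prod_erase_mul _ _ hk, Matrix.smul_mulVec, smul_comm]
  refine zsmul_mem ?_ _
  rw [Nat.cast_mul, mul_smul]
  refine natCast_smul_mem ?_ _
  rw [← Matrix.smul_mulVec]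
  refine hc k _ ⟨Pi.single i 1, ?_⟩
  ext j
  rcases eq_or_ne j i with rfl | h
  · simp [castVec]
  · simp [castVec, h]

/-- The elements of `ℤⁿ[C]` with bounded `C⁻¹`-adic absolute value have bounded denominators. -/
theorem exists_smul_mem_intVectors (hC : IsUnit C.det) (k : ℕ) :
    ∃ c : ℕ, c ≠ 0 ∧ ∀ y ∈ polyModule C ⊓ filt C⁻¹ (-k : ℤ), (c : ℚ) • y ∈ intVectors n := by
  obtain ⟨N, hN⟩ := exists_natDegree_bound hC k
  obtain ⟨c, hc0, hc⟩ := exists_smul_polyEval_mem C N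
  refine ⟨c, hc0, fun y hy => ?_⟩
  obtain ⟨F, hF, rfl⟩ := hN y hy
  exact hc F hF

end Discrete

/-! ### The index of `A ℤⁿ[A]` -/

section Index

variable {n : ℕ}

theorem intVectors_eq_closure :
    intVectors n = AddSubgroup.closure (Set.range (Pi.basisFun ℚ (Fin n))) := by
  refine le_antisymm ?_ ((AddSubgroup.closure_le _).2 ?_)
  · rintro _ ⟨v, rfl⟩
    have : castVec n v = ∑ i, v i • Pi.basisFun ℚ (Fin n) i := by
      ext j
      simp [castVec, Finset.sum_apply, Pi.single_apply]
    rw [this]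
    exact sum_mem fun i _ => zsmul_mem (AddSubgroup.subset_closure (Set.mem_range_self i)) _
  · rintro _ ⟨i, rfl⟩
    refine ⟨Pi.single i 1, ?_⟩
    ext j
    simp [castVec, Pi.single_apply, apply_ite]

theorem relIndex_map_intVectors {C : Matrix (Fin n) (Fin n) ℚ} (hC : IsUnit C.det)
    (hle : (intVectors n).map (matMap C) ≤ intVectors n) :
    (((intVectors n).map (matMap C)).relIndex (intVectors n) : ℚ) = |C.det| := by
  let e := Matrix.toLinearEquiv (Pi.basisFun ℚ (Fin n)) C hC
  have he : ⇑e = ⇑(matMap C) := by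
    funext v
    simp [e, matMap_apply, Matrix.toLinearEquiv, Matrix.toLin_eq_toLin']
  rw [AddSubgroup.relIndex_eq_abs_det _ _ hle ((Pi.basisFun ℚ (Fin n)).map e)
    (Pi.basisFun ℚ (Fin n)) ?_ intVectors_eq_closure]
  · congr 1
    have : ⇑((Pi.basisFun ℚ (Fin n)).map e) = ⇑C.toLin' ∘ ⇑(Pi.basisFun ℚ (Fin n)) := by
      funext i
      simp [he, matMap_apply]
    rw [this, Module.Basis.det_comp, LinearMap.det_toLin', Module.Basis.det_self, mul_one]
  · conv_lhs => rw [intVectors_eq_closure]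
    rw [AddMonoidHom.map_closure, ← Set.range_comp]
    congr 2

/-- Since $[CL:C\mathbb{Z}^n]=[L:\mathbb{Z}^n]$ is finite, computing $[L:C\mathbb{Z}^n]$ in two ways
gives $[L:CL]=[\mathbb{Z}^n:C\mathbb{Z}^n]$. -/
theorem relIndex_map_eq_abs_det {L : AddSubgroup (Fin n → ℚ)} (hL : intVectors n ≤ L)
    (hfin : (intVectors n).relIndex L ≠ 0) {C : Matrix (Fin n) (Fin n) ℚ} (hC : IsUnit C.det)
    (hle : (intVectors n).map (matMap C) ≤ intVectors n) (hCL : L.map (matMap C) ≤ L) :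
    ((L.map (matMap C)).relIndex L : ℚ) = |C.det| := by
  rw [← relIndex_map_intVectors hC hle]
  have h1 := AddSubgroup.relIndex_mul_relIndex _ _ L (AddSubgroup.map_mono (f := matMap C) hL) hCL
  have h2 := AddSubgroup.relIndex_mul_relIndex _ _ L hle hL
  rw [AddSubgroup.relIndex_map_map_of_injective _ _ (matMap_injective hC), ← h2, mul_comm] at h1
  exact_mod_cast Nat.eq_of_mul_eq_mul_right (Nat.pos_of_ne_zero hfin) h1

theorem isUnit_det_natCast_smul_one {c : ℕ} (hc : c ≠ 0) :
    IsUnit ((c : ℚ) • (1 : Matrix (Fin n) (Fin n) ℚ)).det := by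
  rw [Matrix.det_smul, Matrix.det_one, mul_one, isUnit_iff_ne_zero]
  exact pow_ne_zero _ (by exact_mod_cast hc)

theorem matMap_smul_one (c : ℚ) (v : Fin n → ℚ) :
    matMap (c • (1 : Matrix (Fin n) (Fin n) ℚ)) v = c • v := by
  rw [matMap_apply, Matrix.smul_mulVec, Matrix.one_mulVec]

theorem map_natCast_smul_one_le (L : AddSubgroup (Fin n → ℚ)) (c : ℕ) :
    L.map (matMap ((c : ℚ) • (1 : Matrix (Fin n) (Fin n) ℚ))) ≤ L := by
  rintro _ ⟨v, hv, rfl⟩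
  rw [matMap_smul_one]
  exact natCast_smul_mem hv c

/-- In the chain $c\mathbb{Z}^n\le cL\le\mathbb{Z}^n$ the total index is finite, and the lower step
has index $[L:\mathbb{Z}^n]$. -/
theorem relIndex_intVectors_ne_zero {L : AddSubgroup (Fin n → ℚ)} (hL : intVectors n ≤ L) {c : ℕ}
    (hc : c ≠ 0) (hcL : ∀ v ∈ L, (c : ℚ) • v ∈ intVectors n) : (intVectors n).relIndex L ≠ 0 := by
  have hu := isUnit_det_natCast_smul_one (n := n) hc
  set M := (c : ℚ) • (1 : Matrix (Fin n) (Fin n) ℚ) with hM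
  have h1 : L.map (matMap M) ≤ intVectors n := by
    rintro _ ⟨v, hv, rfl⟩
    rw [hM, matMap_smul_one]
    exact hcL v hv
  have h2 := relIndex_map_intVectors hu (map_natCast_smul_one_le _ c)
  rw [← AddSubgroup.relIndex_mul_relIndex _ _ _ (AddSubgroup.map_mono hL) h1,
    AddSubgroup.relIndex_map_map_of_injective _ _ (matMap_injective hu)] at h2
  intro h0
  rw [h0, zero_mul, Nat.cast_zero] at h2
  exact abs_ne_zero.2 hu.ne_zero h2.symm

/-- For a lattice `L ⊇ ℤⁿ`, the determinant of `C` is the generalized index of `C L` in `L`. -/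
theorem relIndex_inf_map_eq {L : AddSubgroup (Fin n → ℚ)} (hL : intVectors n ≤ L) {c : ℕ}
    (hc : c ≠ 0) (hcL : ∀ v ∈ L, (c : ℚ) • v ∈ intVectors n) {C : Matrix (Fin n) (Fin n) ℚ}
    (hC : IsUnit C.det) :
    ((L.map (matMap C)).relIndex L : ℚ) = |C.det| * L.relIndex (L.map (matMap C)) := by
  have hfin := relIndex_intVectors_ne_zero hL hc hcL
  obtain ⟨d, hd, hdC⟩ := exists_integer_multiple C
  -- Here `c` clears the denominators of `L` and `d` those of `C`, so $NCL$ lies in both $L$ and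
  -- $CL$. Both indices are compared through this common sublattice: $[L:NCL]=|\det NC|$ and
  -- $[CL:NCL]=[L:NL]=|\det N|$.
  set N := d * c with hN
  have hN0 : N ≠ 0 := mul_ne_zero hd hc
  have huN := isUnit_det_natCast_smul_one (n := n) hN0
  have hNC : matMap ((N : ℚ) • C) = (matMap ((N : ℚ) • (1 : Matrix (Fin n) (Fin n) ℚ))).comp
      (matMap C) := by
    rw [matMap_comp, Matrix.smul_mul, one_mul]
  have huNC : IsUnit ((N : ℚ) • C).det := by
    rw [Matrix.det_smul]
    exact IsUnit.mul (isUnit_iff_ne_zero.2 (pow_ne_zero _ (by exact_mod_cast hN0))) hC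
  have hsplit : ∀ v, matMap ((N : ℚ) • C) v = matMap ((d : ℚ) • C) ((c : ℚ) • v) := by
    intro v
    simp [hN, matMap_apply, Matrix.smul_mulVec, Matrix.mulVec_smul, mul_smul,
      smul_comm (d : ℚ)]
  have hJL : L.map (matMap ((N : ℚ) • C)) ≤ L := by
    rintro _ ⟨v, hv, rfl⟩
    rw [hsplit]
    exact hL (hdC _ (hcL v hv))
  have hJL' : L.map (matMap ((N : ℚ) • C)) ≤ L.map (matMap C) := by
    rw [hNC, ← AddSubgroup.map_map]
    exact map_natCast_smul_one_le _ N
  have hZ : (intVectors n).map (matMap ((N : ℚ) • C)) ≤ intVectors n := by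
    rintro _ ⟨v, hv, rfl⟩
    rw [hsplit]
    exact hdC _ (natCast_smul_mem hv c)
  have h1 := relIndex_map_eq_abs_det hL hfin huNC hZ hJL
  have h2 := relIndex_map_eq_abs_det hL hfin huN (map_natCast_smul_one_le _ N)
    (map_natCast_smul_one_le _ N)
  have h3 : (L.map (matMap ((N : ℚ) • C))).relIndex (L.map (matMap C))
      = (L.map (matMap ((N : ℚ) • (1 : Matrix (Fin n) (Fin n) ℚ)))).relIndex L := by
    have : matMap ((N : ℚ) • C) = (matMap C).comp
        (matMap ((N : ℚ) • (1 : Matrix (Fin n) (Fin n) ℚ))) := by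
      rw [matMap_comp, Matrix.mul_smul, mul_one]
    rw [this, ← AddSubgroup.map_map,
      AddSubgroup.relIndex_map_map_of_injective _ _ (matMap_injective hC)]
  have h4 := AddSubgroup.relIndex_mul_relIndex _ _ L (le_inf hJL hJL') inf_le_left
  have h5 := AddSubgroup.relIndex_mul_relIndex _ _ _ (le_inf hJL hJL') inf_le_right
  rw [AddSubgroup.inf_relIndex_left] at h4
  rw [AddSubgroup.inf_relIndex_right, h3] at h5
  rw [← h4] at h1
  rw [← h5] at h2
  have e : |((N : ℚ) • C).det| = |((N : ℚ) • (1 : Matrix (Fin n) (Fin n) ℚ)).det| * |C.det| := by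
    rw [← abs_mul, Matrix.det_smul, Matrix.det_smul, Matrix.det_one, mul_one]
  rw [e, ← h2] at h1
  push_cast at h1 h2
  have hne : ((L.map (matMap ((N : ℚ) • C))).relIndex (L ⊓ L.map (matMap C)) : ℚ) ≠ 0 := by
    intro h0
    rw [h0, zero_mul] at h2
    exact abs_ne_zero.2 huN.ne_zero h2.symm
  apply mul_left_cancel₀ hne
  rw [h1]
  ring

/-- `|ℤⁿ[C] / C ℤⁿ[C]| = |det C| · |ℤⁿ[C⁻¹] / C⁻¹ ℤⁿ[C⁻¹]|`. -/
theorem residueCard_eq_abs_det_mul {C : Matrix (Fin n) (Fin n) ℚ} (hC : IsUnit C.det) :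
    (residueCard C : ℚ) = |C.det| * residueCard C⁻¹ := by
  have hC' := Matrix.isUnit_nonsing_inv_det _ hC
  set P := polyModule C with hP
  set Q := polyModule C⁻¹ with hQ
  have hQQ : Q ≤ Q.map (matMap C) := by
    have := filt_succ_le hC' (-1)
    rw [neg_add_cancel, filt_zero, filt, Matrix.zpow_neg_one, Matrix.nonsing_inv_nonsing_inv _ hC]
      at this
    exact this
  have hb : residueCard C⁻¹ = Q.relIndex (Q.map (matMap C)) := by
    have := relIndex_filt_succ hC' (-1)
    rw [neg_add_cancel, filt_zero, filt, Matrix.zpow_neg_one, Matrix.nonsing_inv_nonsing_inv _ hC]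
      at this
    exact this.symm
  have hPP : P.map (matMap C) ≤ P := map_polyModule_le
  have hL : intVectors n ≤ P ⊓ Q := le_inf intVectors_le intVectors_le
  have hLmap : (P ⊓ Q).map (matMap C) = P.map (matMap C) ⊓ Q.map (matMap C) :=
    AddSubgroup.map_inf _ _ _ (matMap_injective hC)
  -- Bounded denominators at level `0` make $L=P\cap Q$ a lattice.
  obtain ⟨c, hc, hcL⟩ := exists_smul_mem_intVectors hC 0
  rw [Nat.cast_zero, neg_zero, filt_zero] at hcL
  -- As $P=L+CP$, the quotient $P/CP$ is $L/(L\cap CP)$, and $L\cap CP=L\cap CL$ because $Q\le CQ$.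
  have ha : residueCard C = ((P ⊓ Q).map (matMap C)).relIndex (P ⊓ Q) := by
    have h1 : P = (P ⊓ Q) ⊔ P.map (matMap C) := by
      refine le_antisymm ?_ (sup_le inf_le_left hPP)
      conv_lhs => rw [hP, polyModule_eq_sup]
      exact sup_le_sup_right hL _
    rw [residueCard_eq, ← hP]
    conv_lhs => arg 2; rw [h1]
    rw [AddSubgroup.relIndex_sup_right, ← AddSubgroup.inf_relIndex_right,
      ← AddSubgroup.inf_relIndex_right (AddSubgroup.map _ (P ⊓ Q)), hLmap]
    congr 1
    refine le_antisymm ?_ ?_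
    · exact le_inf (le_inf inf_le_left (inf_le_right.trans (inf_le_right.trans hQQ))) inf_le_right
    · exact le_inf (inf_le_left.trans inf_le_left) inf_le_right
  -- Dually $CQ=CL+Q$, so $CQ/Q$ is $CL/(CL\cap Q)$, and $CL\cap Q=CL\cap L$ because $CP\le P$.
  have hb' : residueCard C⁻¹ = (P ⊓ Q).relIndex ((P ⊓ Q).map (matMap C)) := by
    have h1 : Q.map (matMap C) = (P ⊓ Q).map (matMap C) ⊔ Q := by
      refine le_antisymm ?_ (sup_le (AddSubgroup.map_mono inf_le_right) hQQ)
      conv_lhs => rw [hQ, polyModule_eq_sup, AddSubgroup.map_sup]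
      refine sup_le_sup (AddSubgroup.map_mono hL) ?_
      rw [AddSubgroup.map_map, matMap_comp, Matrix.mul_nonsing_inv _ hC, matMap_one,
        AddSubgroup.map_id]
    rw [hb, h1, AddSubgroup.relIndex_sup_right, ← AddSubgroup.inf_relIndex_right,
      ← AddSubgroup.inf_relIndex_right (P ⊓ Q), hLmap]
    congr 1
    refine le_antisymm ?_ ?_
    · exact le_inf (le_inf (inf_le_right.trans (inf_le_left.trans hPP)) inf_le_left) inf_le_right
    · exact le_inf (inf_le_left.trans inf_le_right) inf_le_right
  rw [ha, hb', relIndex_inf_map_eq hL hc hcL hC]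

end Index

variable {n : ℕ}

/-! ### Contraction of the inverse on `ℝⁿ` -/

/-- Gelfand's formula compares $\|a^k\|$ eventually with a geometric series. The trivial ring is
separate since it occurs for $n=0$. -/
theorem summable_norm_pow_of_spectrum {R : Type*} [NormedRing R] [NormedAlgebra ℂ R]
    [CompleteSpace R] (a : R) (ha : ∀ z ∈ spectrum ℂ a, ‖z‖ < 1) :
    Summable fun k : ℕ => ‖a ^ k‖ := by
  rcases subsingleton_or_nontrivial R with hR | hR
  · have : (fun k : ℕ => ‖a ^ k‖) = fun _ => 0 := by
      funext k
      rw [Subsingleton.elim (a ^ k) 0, norm_zero]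
    rw [this]
    exact summable_zero
  have h1 : spectralRadius ℂ a < (1 : ℝ≥0) :=
    spectrum.spectralRadius_lt_of_forall_lt a fun z hz => by exact_mod_cast ha z hz
  obtain ⟨r, hr1, hr2⟩ := ENNReal.lt_iff_exists_nnreal_btwn.1 h1
  have hr : r < 1 := by exact_mod_cast hr2
  have h2 := (spectrum.pow_nnnorm_pow_one_div_tendsto_nhds_spectralRadius a).eventually
    (gt_mem_nhds hr1)
  refine Summable.of_norm_bounded_eventually_nat
    (NNReal.summable_coe.2 (NNReal.summable_geometric hr)) ?_
  filter_upwards [h2, eventually_gt_atTop 0] with k hk hk0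
  rw [one_div, ENNReal.rpow_inv_lt_iff (by exact_mod_cast hk0), ENNReal.rpow_natCast] at hk
  rw [norm_norm]
  exact_mod_cast hk.le

theorem norm_lt_one_of_mem_spectrum_inv (A : ExpandingMatrix n) {z : ℂ}
    (hz : z ∈ spectrum ℂ (A.1⁻¹.map (algebraMap ℚ ℂ))) : ‖z‖ < 1 := by
  have hu := isUnit_det A
  have h1 : A.1.map (algebraMap ℚ ℂ) * A.1⁻¹.map (algebraMap ℚ ℂ) = 1 := by
    rw [← Matrix.map_mul, Matrix.mul_nonsing_inv _ hu, Matrix.map_one _ (map_zero _) (map_one _)]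
  have h2 : A.1⁻¹.map (algebraMap ℚ ℂ) * A.1.map (algebraMap ℚ ℂ) = 1 := by
    rw [← Matrix.map_mul, Matrix.nonsing_inv_mul _ hu, Matrix.map_one _ (map_zero _) (map_one _)]
  obtain ⟨u, hu1, hu2⟩ : ∃ u : (Matrix (Fin n) (Fin n) ℂ)ˣ,
      (u : Matrix (Fin n) (Fin n) ℂ) = A.1.map (algebraMap ℚ ℂ) ∧
        ((u⁻¹ : (Matrix (Fin n) (Fin n) ℂ)ˣ) : Matrix (Fin n) (Fin n) ℂ)
          = A.1⁻¹.map (algebraMap ℚ ℂ) := ⟨⟨_, _, h1, h2⟩, rfl, rfl⟩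
  rw [← hu2] at hz
  have hz0 : z ≠ 0 := spectrum.ne_zero_of_mem_of_unit hz
  have h3 := (spectrum.inv_mem_iff (r := Units.mk0 z hz0) (a := u⁻¹)).1 hz
  rw [inv_inv, hu1] at h3
  have h4 := A.2 _ h3
  simp only [Units.val_inv_eq_inv_val, Units.val_mk0, norm_inv] at h4
  exact (one_lt_inv₀ (norm_pos_iff.2 hz0)).1 h4

/-- Multiplication by a rational matrix on `ℝⁿ`. -/
def realMul (C : Matrix (Fin n) (Fin n) ℚ) :
    EuclideanSpace ℝ (Fin n) →L[ℝ] EuclideanSpace ℝ (Fin n) :=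
  Matrix.toEuclideanCLM (𝕜 := ℝ) (C.map (algebraMap ℚ ℝ))

theorem realMul_mul (C C' : Matrix (Fin n) (Fin n) ℚ) :
    realMul (C * C') = realMul C * realMul C' := by
  rw [realMul, Matrix.map_mul, map_mul]
  rfl

theorem realMul_one : realMul (1 : Matrix (Fin n) (Fin n) ℚ) = 1 := by
  rw [realMul, Matrix.map_one _ (map_zero _) (map_one _), map_one]

/-- The spectral radius formula lives over $\mathbb{C}$; the isometric embedding
$\mathbb{R}^n\subset\mathbb{C}^n$ transfers its bounds. -/
theorem norm_realMul_iterate_le (C : Matrix (Fin n) (Fin n) ℚ) (k : ℕ)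
    (x : EuclideanSpace ℝ (Fin n)) :
    ‖(realMul C)^[k] x‖ ≤
      ‖Matrix.toEuclideanCLM (𝕜 := ℂ) (C.map (algebraMap ℚ ℂ)) ^ k‖ * ‖x‖ := by
  set M := Matrix.toEuclideanCLM (𝕜 := ℂ) (C.map (algebraMap ℚ ℂ))
  let j : EuclideanSpace ℝ (Fin n) → EuclideanSpace ℂ (Fin n) :=
    fun x => WithLp.toLp 2 fun i => (x i : ℂ)
  have hj : ∀ x, ‖j x‖ = ‖x‖ := fun x => by simp [j, EuclideanSpace.norm_eq]
  have hM : ∀ x, j (realMul C x) = M (j x) := by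
    intro x
    ext i
    simp [j, M, realMul, Matrix.ofLp_toEuclideanCLM, Matrix.mulVec, dotProduct]
  have hk : j ((realMul C)^[k] x) = (M ^ k) (j x) := by
    induction k with
    | zero => rfl
    | succ k ih => rw [Function.iterate_succ_apply', hM, ih, pow_succ']; rfl
  rw [← hj, hk, ← hj x]
  exact (M ^ k).le_opNorm _

theorem summable_norm_inv_pow (A : ExpandingMatrix n) :
    Summable fun k : ℕ =>
      ‖Matrix.toEuclideanCLM (𝕜 := ℂ) (A.1⁻¹.map (algebraMap ℚ ℂ)) ^ k‖ := by
  refine summable_norm_pow_of_spectrum _ fun z hz => norm_lt_one_of_mem_spectrum_inv A ?_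
  rwa [AlgEquiv.spectrum_eq] at hz

/-! ### Multiplication by `A` on `ℤⁿ((B))` -/

variable (A : ExpandingMatrix n)

theorem matMap_mem_laurentModule {C : Matrix (Fin n) (Fin n) ℚ} (hC : IsUnit C.det)
    {y : Fin n → ℚ} (hy : y ∈ laurentModule C) : matMap C y ∈ laurentModule C := by
  have h : (laurentModule C).map (matMap C) ≤ laurentModule C := by
    conv_lhs => rw [laurentModule]
    rw [AddSubgroup.map_iSup]
    refine iSup_le fun k => ?_
    rw [AddSubgroup.map_map, matMap_comp]
    have : C * C ^ k = C ^ (1 + k) := by rw [Matrix.zpow_add hC, zpow_one]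
    rw [this]
    exact le_iSup (fun k : ℤ => (intVectors n).map (matMap (C ^ k))) (1 + k)
  exact h ⟨y, hy, rfl⟩

/-- Multiplication by `B = A⁻¹` on `ℤⁿ(B)`. -/
def LaurentGroup.mulInv : LaurentGroup A →+ LaurentGroup A :=
  ((matMap A.1⁻¹).comp (laurentModule (A.1⁻¹)).subtype).codRestrict (laurentModule (A.1⁻¹))
    fun y => matMap_mem_laurentModule (isUnit_det_inv A) y.2

theorem LaurentGroup.mulA_mulInv (y : LaurentGroup A) :
    LaurentGroup.mulA A (LaurentGroup.mulInv A y) = y := by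
  refine Subtype.ext ?_
  change matMap A.1 (matMap A.1⁻¹ _) = _
  rw [matMap_apply, matMap_apply, Matrix.mulVec_mulVec, Matrix.mul_nonsing_inv _ (isUnit_det A),
    Matrix.one_mulVec]
  rfl

theorem LaurentGroup.mulInv_mulA (y : LaurentGroup A) :
    LaurentGroup.mulInv A (LaurentGroup.mulA A y) = y := by
  refine Subtype.ext ?_
  change matMap A.1⁻¹ (matMap A.1 _) = _
  rw [matMap_apply, matMap_apply, Matrix.mulVec_mulVec, Matrix.nonsing_inv_mul _ (isUnit_det A),
    Matrix.one_mulVec]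
  rfl

theorem LaurentGroup.norm_mulA (y : LaurentGroup A) :
    ‖LaurentGroup.mulA A y‖ = residueCard (A.1⁻¹) * ‖y‖ := by
  have h := adicAbs_matMap_inv (isUnit_det_inv A) _ y.2
  rw [Matrix.nonsing_inv_nonsing_inv _ (isUnit_det A)] at h
  exact h

/-- If `y ∉ Bᵏ ℤⁿ[B]` then the residue group is nontrivial and `|y| ≥ b ^ (1 - k)`. -/
theorem LaurentGroup.le_norm_of_notMem {y : LaurentGroup A} {k : ℤ}
    (h : LaurentGroup.val A y ∉ filt (A.1⁻¹) k) :
    2 ≤ residueCard (A.1⁻¹) ∧ (residueCard (A.1⁻¹) : ℝ) ^ (1 - k) ≤ ‖y‖ := by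
  have hC := isUnit_det_inv A
  obtain ⟨j, hj⟩ := exists_mem_filt hC y.2
  obtain ⟨m, hm, h1, h2⟩ := exists_level hC hj h
  have hb : residueCard (A.1⁻¹) ≠ 1 := by
    intro hb
    rw [← relIndex_filt_succ hC m, AddSubgroup.relIndex_eq_one] at hb
    exact h2 (hb h1)
  have hb0 := residueCard_ne_zero hC
  refine ⟨by omega, ?_⟩
  rw [LaurentGroup.norm_def]
  have h1' : LaurentGroup.val A y ∈ filt (A.1⁻¹) m := h1
  rw [adicAbs_eq hC h1' h2]
  exact zpow_le_zpow_right₀ (one_le_residueCard hC) (by omega)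

/-- Multiplication by $B$ divides the norm by $b$. If $b\ge2$ this gives the factor $1/2$; if $b=1$
every norm is zero. -/
theorem LaurentGroup.norm_mulInv_le (y : LaurentGroup A) :
    ‖LaurentGroup.mulInv A y‖ ≤ 2⁻¹ * ‖y‖ := by
  have h := LaurentGroup.norm_mulA A (LaurentGroup.mulInv A y)
  rw [LaurentGroup.mulA_mulInv] at h
  by_cases h0 : ∀ k, LaurentGroup.val A (LaurentGroup.mulInv A y) ∈ filt (A.1⁻¹) k
  · rw [LaurentGroup.norm_def, adicAbs_eq_zero h0]
    positivity
  · push Not at h0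
    obtain ⟨k, hk⟩ := h0
    have hb : (2 : ℝ) ≤ residueCard (A.1⁻¹) := by
      exact_mod_cast (LaurentGroup.le_norm_of_notMem A hk).1
    have := mul_le_mul_of_nonneg_right hb (norm_nonneg (LaurentGroup.mulInv A y))
    linarith

theorem LaurentGroup.continuous_mulInv : Continuous (LaurentGroup.mulInv A) :=
  AddMonoidHomClass.continuous_of_bound _ 2⁻¹ (LaurentGroup.norm_mulInv_le A)

theorem LaurentGroup.norm_add_le_max (x y : LaurentGroup A) : ‖x + y‖ ≤ max ‖x‖ ‖y‖ := by
  rw [LaurentGroup.norm_def, map_add]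
  exact adicAbs_add (isUnit_det_inv A) x.2 y.2

theorem AdicSpace.norm_add_le_max (x y : AdicSpace A) : ‖x + y‖ ≤ max ‖x‖ ‖y‖ := by
  refine Completion.induction_on₂ x y
    (isClosed_le (by fun_prop) (by fun_prop)) fun x y => ?_
  rw [← Completion.coe_add, Completion.norm_coe, Completion.norm_coe, Completion.norm_coe]
  exact LaurentGroup.norm_add_le_max A x y

theorem AdicSpace.continuous_mulA : Continuous (AdicSpace.mulA A) :=
  AddMonoidHom.continuous_completion _ _

theorem AdicSpace.mulA_coe (y : LaurentGroup A) :
    AdicSpace.mulA A (y : AdicSpace A) = (LaurentGroup.mulA A y : AdicSpace A) :=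
  AddMonoidHom.completion_coe _ _ _

/-- Multiplication by `B = A⁻¹` on `ℤⁿ((B))`. -/
def AdicSpace.mulInv : AdicSpace A →+ AdicSpace A :=
  (LaurentGroup.mulInv A).completion (LaurentGroup.continuous_mulInv A)

theorem AdicSpace.continuous_mulInv : Continuous (AdicSpace.mulInv A) :=
  AddMonoidHom.continuous_completion _ _

theorem AdicSpace.mulInv_coe (y : LaurentGroup A) :
    AdicSpace.mulInv A (y : AdicSpace A) = (LaurentGroup.mulInv A y : AdicSpace A) :=
  AddMonoidHom.completion_coe _ _ _

theorem AdicSpace.mulA_mulInv (y : AdicSpace A) :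
    AdicSpace.mulA A (AdicSpace.mulInv A y) = y := by
  refine Completion.induction_on y (isClosed_eq
    ((AdicSpace.continuous_mulA A).comp (AdicSpace.continuous_mulInv A)) continuous_id) fun y => ?_
  rw [AdicSpace.mulInv_coe, AdicSpace.mulA_coe, LaurentGroup.mulA_mulInv]

theorem AdicSpace.mulInv_mulA (y : AdicSpace A) :
    AdicSpace.mulInv A (AdicSpace.mulA A y) = y := by
  refine Completion.induction_on y (isClosed_eq
    ((AdicSpace.continuous_mulInv A).comp (AdicSpace.continuous_mulA A)) continuous_id) fun y => ?_
  rw [AdicSpace.mulA_coe, AdicSpace.mulInv_coe, LaurentGroup.mulInv_mulA]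

theorem AdicSpace.norm_mulA (y : AdicSpace A) :
    ‖AdicSpace.mulA A y‖ = residueCard (A.1⁻¹) * ‖y‖ := by
  refine Completion.induction_on y (isClosed_eq (AdicSpace.continuous_mulA A).norm
    (continuous_const.mul continuous_norm)) fun y => ?_
  rw [AdicSpace.mulA_coe, Completion.norm_coe, Completion.norm_coe, LaurentGroup.norm_mulA]

theorem AdicSpace.norm_mulInv_le (y : AdicSpace A) : ‖AdicSpace.mulInv A y‖ ≤ 2⁻¹ * ‖y‖ := by
  refine Completion.induction_on y (isClosed_le (AdicSpace.continuous_mulInv A).norm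
    (continuous_const.mul continuous_norm)) fun y => ?_
  rw [AdicSpace.mulInv_coe, Completion.norm_coe, Completion.norm_coe]
  exact LaurentGroup.norm_mulInv_le A y

theorem AdicSpace.norm_mulInv_iterate_le (k : ℕ) (y : AdicSpace A) :
    ‖(AdicSpace.mulInv A)^[k] y‖ ≤ (2⁻¹ : ℝ) ^ k * ‖y‖ := by
  induction k with
  | zero => simp
  | succ k ih =>
    rw [Function.iterate_succ_apply', pow_succ', mul_assoc]
    exact (AdicSpace.norm_mulInv_le A _).trans (mul_le_mul_of_nonneg_left ih (by norm_num))

instance : Countable (LaurentGroup A) := inferInstanceAs (Countable (laurentModule (A.1⁻¹)))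

instance : SecondCountableTopology (AdicSpace A) :=
  UniformSpace.secondCountable_of_separable (AdicSpace A)

instance : LocallyCompactSpace (AdicSpace A) :=
  (AdicSpace.isCompact_closedBall A).locallyCompactSpace_of_mem_nhds_of_addGroup
    (Metric.closedBall_mem_nhds 0 one_pos)

instance : (AdicSpace.haar A).IsAddHaarMeasure :=
  inferInstanceAs (Measure.addHaarMeasure _).IsAddHaarMeasure

theorem AdicSpace.haar_closedBall : AdicSpace.haar A (Metric.closedBall 0 1) = 1 :=
  Measure.addHaarMeasure_self (K₀ := AdicSpace.unitBall A)

/-- `A ℤⁿ[[B]]` contains `b` disjoint translates of `ℤⁿ[[B]]`. -/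
theorem AdicSpace.residueCard_le_haar_image :
    (residueCard (A.1⁻¹) : ℝ≥0∞) ≤
      AdicSpace.haar A (AdicSpace.mulA A '' Metric.closedBall 0 1) := by
  have hC := isUnit_det_inv A
  have hb := one_le_residueCard hC
  -- The $b$ cosets of $\mathbb{Z}^n[B]$ in $B^{-1}\mathbb{Z}^n[B]$ index the translates. If two
  -- translates of the unit ball meet, the ultrametric inequality puts the difference of their
  -- centres in $\mathbb{Z}^n[B]$, so the cosets agree.
  let Q := filt (A.1⁻¹) (-1) ⧸ (filt (A.1⁻¹) 0).addSubgroupOf (filt (A.1⁻¹) (-1))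
  have hcard : Nat.card Q = residueCard (A.1⁻¹) := relIndex_filt_succ hC (-1)
  have hfin : Finite Q := Nat.finite_of_card_ne_zero (hcard ▸ residueCard_ne_zero hC)
  have := Fintype.ofFinite Q
  let f : Q → LaurentGroup A := fun q => ⟨q.out.1, filt_le_laurent hC (-1) q.out.2⟩
  have hf : ∀ q q', ‖f q - f q'‖ < 2 → q' = q := by
    intro q q' h
    have h1 := LaurentGroup.norm_lt_two A h
    rw [← QuotientAddGroup.out_eq' q, ← QuotientAddGroup.out_eq' q', QuotientAddGroup.eq]
    rw [map_sub, sub_eq_neg_add] at h1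
    exact h1
  let V : Q → Set (AdicSpace A) := fun q =>
    (fun z => z + -(f q : AdicSpace A)) ⁻¹' Metric.closedBall 0 1
  have hV : ∀ q z, z ∈ V q ↔ ‖z - f q‖ ≤ 1 := fun q z => by
    rw [sub_eq_add_neg, ← mem_closedBall_zero_iff]
    rfl
  have hdisj : Pairwise (Function.onFun Disjoint V) := by
    intro q q' hqq
    refine Set.disjoint_left.2 fun z hz hz' => hqq (hf q q' ?_).symm
    rw [hV] at hz hz'
    have h1 := AdicSpace.norm_add_le_max A (-(z - f q)) (z - f q')
    have e : -(z - (f q : AdicSpace A)) + (z - f q')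
        = ((f q - f q' : LaurentGroup A) : AdicSpace A) := by
      rw [Completion.coe_sub]
      abel
    rw [e, Completion.norm_coe, norm_neg] at h1
    exact (h1.trans (max_le hz hz')).trans_lt one_lt_two
  have hsub : ⋃ q, V q ⊆ AdicSpace.mulA A '' Metric.closedBall 0 1 := by
    refine iUnion_subset fun q z hz => ⟨AdicSpace.mulInv A z, ?_, AdicSpace.mulA_mulInv A z⟩
    rw [hV] at hz
    have h1 := AdicSpace.norm_add_le_max A (z - f q) (f q)
    rw [sub_add_cancel, Completion.norm_coe] at h1
    have h2 : ‖f q‖ ≤ residueCard (A.1⁻¹) := by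
      have := adicAbs_le_of_mem hC (q.out.2)
      rwa [neg_neg, zpow_one] at this
    have h3 := AdicSpace.norm_mulA A (AdicSpace.mulInv A z)
    rw [AdicSpace.mulA_mulInv] at h3
    rw [mem_closedBall_zero_iff]
    have h4 := h1.trans (max_le (hz.trans hb) h2)
    rw [h3] at h4
    exact le_of_mul_le_mul_left (a := (residueCard (A.1⁻¹) : ℝ)) (by linarith) (by linarith)
  refine le_trans (le_of_eq ?_) (measure_mono hsub)
  rw [measure_iUnion hdisj fun q => (measurable_add_const _) Metric.isClosed_closedBall.measurableSet]
  simp only [V, measure_preimage_add_right, AdicSpace.haar_closedBall]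
  rw [tsum_fintype, Finset.sum_const, Finset.card_univ, ← Nat.card_eq_fintype_card, hcard,
    nsmul_one]

/-! ### Multiplication by `A` on the representation space -/

theorem realMul_realMul_inv (x : EuclideanSpace ℝ (Fin n)) :
    realMul A.1 (realMul A.1⁻¹ x) = x := by
  rw [← mul_apply_eq_comp, ← realMul_mul, Matrix.mul_nonsing_inv _ (isUnit_det A),
    realMul_one, one_apply_eq_self]

theorem realMul_inv_realMul (x : EuclideanSpace ℝ (Fin n)) :
    realMul A.1⁻¹ (realMul A.1 x) = x := by
  rw [← mul_apply_eq_comp, ← realMul_mul, Matrix.nonsing_inv_mul _ (isUnit_det A),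
    realMul_one, one_apply_eq_self]

theorem RepSpace.mulA_eq : RepSpace.mulA A = Prod.map (realMul A.1) (AdicSpace.mulA A) := rfl

/-- Multiplication by `A` as an automorphism of the representation space. -/
def RepSpace.mulEquiv : RepSpace A ≃ₜ+ RepSpace A where
  toFun := RepSpace.mulA A
  invFun := Prod.map (realMul A.1⁻¹) (AdicSpace.mulInv A)
  left_inv z := Prod.ext (realMul_inv_realMul A z.1) (AdicSpace.mulInv_mulA A z.2)
  right_inv z := Prod.ext (realMul_realMul_inv A z.1) (AdicSpace.mulA_mulInv A z.2)
  map_add' z w := Prod.ext (map_add (realMul A.1) z.1 w.1) (map_add (AdicSpace.mulA A) z.2 w.2)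
  continuous_toFun := (realMul A.1).continuous.prodMap (AdicSpace.continuous_mulA A)
  continuous_invFun := (realMul A.1⁻¹).continuous.prodMap (AdicSpace.continuous_mulInv A)

theorem RepSpace.coe_mulEquiv : ⇑(RepSpace.mulEquiv A) = RepSpace.mulA A := rfl

/-- The norm is the maximum over the two factors, so the sum of the two contraction rates bounds it.
-/
theorem RepSpace.contractsWith : ContractsWith (RepSpace.mulEquiv A) fun k =>
    ‖Matrix.toEuclideanCLM (𝕜 := ℂ) (A.1⁻¹.map (algebraMap ℚ ℂ)) ^ k‖ + (2⁻¹ : ℝ) ^ k := by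
  refine ⟨(summable_norm_inv_pow A).add
    (summable_geometric_of_lt_one (by norm_num) (by norm_num)), fun k z => ?_⟩
  have h : ⇑(RepSpace.mulEquiv A).symm = Prod.map (realMul A.1⁻¹) (AdicSpace.mulInv A) := rfl
  rw [h, Prod.map_iterate, Prod.norm_def]
  refine max_le ?_ ?_
  · refine (norm_realMul_iterate_le A.1⁻¹ k z.1).trans ?_
    exact mul_le_mul (le_add_of_nonneg_right (by positivity)) (norm_fst_le z) (norm_nonneg _)
      (by positivity)
  · refine (AdicSpace.norm_mulInv_iterate_le A k z.2).trans ?_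
    exact mul_le_mul (le_add_of_nonneg_left (norm_nonneg _)) (norm_snd_le z) (norm_nonneg _)
      (by positivity)

instance : (RepSpace.measure A).IsAddHaarMeasure :=
  inferInstanceAs ((volume : Measure (EuclideanSpace ℝ (Fin n))).prod
    (AdicSpace.haar A)).IsAddHaarMeasure

theorem volume_image_realMul (C : Matrix (Fin n) (Fin n) ℚ) (S : Set (EuclideanSpace ℝ (Fin n))) :
    volume (realMul C '' S) = ENNReal.ofReal ((|C.det| : ℚ) : ℝ) * volume S := by
  rw [Measure.addHaar_image_continuousLinearMap]
  congr 2
  have : ((realMul C : EuclideanSpace ℝ (Fin n) →L[ℝ] EuclideanSpace ℝ (Fin n)) :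
      EuclideanSpace ℝ (Fin n) →ₗ[ℝ] EuclideanSpace ℝ (Fin n))
      = Matrix.toLin (EuclideanSpace.basisFun (Fin n) ℝ).toBasis
        (EuclideanSpace.basisFun (Fin n) ℝ).toBasis (C.map (algebraMap ℚ ℝ)) := by
    rw [realMul, Matrix.coe_toEuclideanCLM_eq_toEuclideanLin,
      Matrix.toEuclideanLin_eq_toLin_orthonormal]
  rw [this, LinearMap.det_toLin]
  have h : (C.map (algebraMap ℚ ℝ)).det = algebraMap ℚ ℝ C.det := ((algebraMap ℚ ℝ).map_det C).symm
  rw [h]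
  simp

/-- `A` multiplies the measure `μ` by at least `|ℤⁿ[A] / A ℤⁿ[A]|`. -/
theorem residueCard_le_addHaarChar :
    (residueCard A.1 : ℝ≥0) ≤ addEquivAddHaarChar (RepSpace.mulEquiv A) := by
  -- The scaling factor is read off from a product of unit balls: $|\det A|$ on the real factor, at
  -- least $b$ on the adic one.
  let E : Set (RepSpace A) := Metric.ball 0 1 ×ˢ Metric.closedBall 0 1
  have h1 := measure_image_equiv (RepSpace.measure A) (RepSpace.mulEquiv A) E
  have h2 : RepSpace.mulEquiv A '' E
      = (realMul A.1 '' Metric.ball 0 1) ×ˢ (AdicSpace.mulA A '' Metric.closedBall 0 1) := by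
    rw [RepSpace.coe_mulEquiv, RepSpace.mulA_eq]
    exact prodMap_image_prod _ _ _ _
  have h3 := AdicSpace.residueCard_le_haar_image A
  have hv0 : volume (Metric.ball (0 : EuclideanSpace ℝ (Fin n)) 1) ≠ 0 :=
    (Metric.measure_ball_pos _ _ one_pos).ne'
  have hv1 : volume (Metric.ball (0 : EuclideanSpace ℝ (Fin n)) 1) ≠ ∞ := measure_ball_lt_top.ne
  have h4 : (residueCard A.1 : ℝ≥0∞)
      = ENNReal.ofReal ((|A.1.det| : ℚ) : ℝ) * residueCard A.1⁻¹ := by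
    rw [← ENNReal.ofReal_natCast, ← ENNReal.ofReal_natCast, ← ENNReal.ofReal_mul (by positivity)]
    congr 1
    exact_mod_cast residueCard_eq_abs_det_mul (isUnit_det A)
  rw [h2, RepSpace.measure, Measure.prod_prod, Measure.prod_prod, AdicSpace.haar_closedBall,
    mul_one, volume_image_realMul, ENNReal.smul_def, smul_eq_mul, mul_right_comm] at h1
  rw [ENNReal.mul_left_inj hv0 hv1] at h1
  have h5 := mul_le_mul_right h3 (ENNReal.ofReal ((|A.1.det| : ℚ) : ℝ))
  rw [← h4, h1] at h5
  exact_mod_cast h5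

/-! ### The image of the digit module -/

/-- The diagonal embedding of `ℤⁿ[A]`, as a homomorphism. -/
def diagonalHom : polyModule A.1 →+ RepSpace A where
  toFun d := diagonal A (polyToLaurent A d)
  map_zero' := by
    refine Prod.ext ?_ ?_
    · ext i
      simp [diagonal]
    · simpa [diagonal] using Completion.coe_zero
  map_add' d d' := by
    refine Prod.ext ?_ ?_
    · ext i
      simp [diagonal]
    · simp [diagonal, Completion.coe_add]

theorem mulEquiv_mem_range_diagonalHom {z : RepSpace A} (hz : z ∈ (diagonalHom A).range) :
    RepSpace.mulEquiv A z ∈ (diagonalHom A).range := by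
  obtain ⟨d, rfl⟩ := hz
  refine ⟨⟨matMap A.1 d, map_polyModule_le ⟨_, d.2, rfl⟩⟩, Prod.ext ?_ ?_⟩
  · ext i
    change ((matMap A.1 d i : ℚ) : ℝ)
      = ((A.1.map (algebraMap ℚ ℝ)).mulVec fun i => ((d : Fin n → ℚ) i : ℝ)) i
    simp [matMap_apply, Matrix.mulVec, dotProduct]
  · exact (AdicSpace.mulA_coe A (polyToLaurent A d)).symm

theorem finite_setOf_abs_le_of_smul_mem {c : ℕ} (hc : c ≠ 0) (R : ℝ) :
    {y : Fin n → ℚ | (c : ℚ) • y ∈ intVectors n ∧ ∀ i, |(y i : ℝ)| ≤ R}.Finite := by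
  let m : ℤ := ⌈c * R⌉
  refine ((Set.finite_Icc (fun _ : Fin n => -m) (fun _ => m)).image
    fun v => (c : ℚ)⁻¹ • castVec n v).subset ?_
  rintro y ⟨⟨v, hv⟩, hy⟩
  refine ⟨v, ?_, ?_⟩
  · have h : ∀ i, |v i| ≤ m := by
      intro i
      have h1 : ((v i : ℤ) : ℚ) = c * y i := congr_fun hv i
      have h2 : ((v i : ℤ) : ℝ) = c * (y i : ℝ) := by exact_mod_cast congrArg (Rat.cast : ℚ → ℝ) h1
      have h3 : |((v i : ℤ) : ℝ)| ≤ c * R := by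
        rw [h2, abs_mul, Nat.abs_cast]
        exact mul_le_mul_of_nonneg_left (hy i) (by positivity)
      have h4 := h3.trans (Int.le_ceil _)
      exact_mod_cast h4
    exact ⟨fun i => (abs_le.1 (h i)).1, fun i => (abs_le.1 (h i)).2⟩
  · change (c : ℚ)⁻¹ • castVec n v = y
    rw [hv, smul_smul, inv_mul_cancel₀ (by exact_mod_cast hc), one_smul]

/-- The image of `ℤⁿ[A]` in the representation space is uniformly discrete. -/
theorem finite_range_diagonalHom_inter (R : ℝ) :
    {z | z ∈ (diagonalHom A).range ∧ ‖z‖ ≤ R}.Finite := by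
  -- With $2^k>R$, an element outside $B^{-k}\mathbb{Z}^n[B]$ would have adic norm at least
  -- $b^{k+1}\ge2^k>R$.
  obtain ⟨k, hk⟩ := pow_unbounded_of_one_lt R one_lt_two
  obtain ⟨c, hc, hmem⟩ := exists_smul_mem_intVectors (isUnit_det A) k
  have hfin : {d : polyModule A.1 | (c : ℚ) • (d : Fin n → ℚ) ∈ intVectors n ∧
      ∀ i, |((d : Fin n → ℚ) i : ℝ)| ≤ R}.Finite :=
    (finite_setOf_abs_le_of_smul_mem hc R).preimage Subtype.val_injective.injOn
  refine (hfin.image (diagonalHom A)).subset ?_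
  rintro _ ⟨⟨d, rfl⟩, hd⟩
  refine ⟨d, ⟨hmem _ ⟨d.2, ?_⟩, fun i => ?_⟩, rfl⟩
  · by_contra hnot
    have h1 := LaurentGroup.le_norm_of_notMem A (y := polyToLaurent A d) hnot
    have h2 : ‖polyToLaurent A d‖ ≤ R := by
      rw [← Completion.norm_coe]
      exact (norm_snd_le (diagonalHom A d)).trans hd
    have hb : (2 : ℝ) ≤ residueCard (A.1⁻¹) := by exact_mod_cast h1.1
    have h3 : (2 : ℝ) ^ k ≤ (residueCard (A.1⁻¹) : ℝ) ^ k := pow_le_pow_left₀ (by norm_num) hb k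
    have h4 : (residueCard (A.1⁻¹) : ℝ) ^ k ≤ (residueCard (A.1⁻¹) : ℝ) ^ (1 - -(k : ℤ)) := by
      rw [← zpow_natCast]
      exact zpow_le_zpow_right₀ (by linarith) (by omega)
    linarith [h1.2]
  · exact (PiLp.norm_apply_le (diagonalHom A d).1 i).trans ((norm_fst_le _).trans hd)

end RationalTile

/-! ### The main theorem -/

open RationalTile MeasureTheory

theorem mainTheorem3 {n : ℕ} (A : RationalTile.ExpandingMatrix n)
    (D : Finset (RationalTile.polyModule A.1)) (hD : RationalTile.IsDigitSystem A D) :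
    (∃! F : Set (RationalTile.RepSpace A), RationalTile.IsSelfAffine A D F) ∧
      ∀ F : Set (RationalTile.RepSpace A), RationalTile.IsSelfAffine A D F →
        List.TFAE
          [0 < RationalTile.RepSpace.measure A F,
            (interior F).Nonempty,
            F = closure (interior F) ∧ RationalTile.RepSpace.measure A (frontier F) = 0] := by
  let t : D → RepSpace A := fun d => diagonalHom A d
  have hcon := RepSpace.contractsWith A
  have hunion : ∀ F : Set (RepSpace A),
      (⋃ d ∈ D, (fun z => z + diagonal A (polyToLaurent A d)) '' F)
        = ⋃ d : D, (fun z => z + t d) '' F := fun F =>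
    Set.biUnion_eq_iUnion (D : Set (polyModule A.1))
      fun d _ => (fun z => z + diagonal A (polyToLaurent A d)) '' F
  have hne : Nonempty D := by
    have : D.card ≠ 0 := by
      rw [hD]
      exact residueCard_ne_zero (isUnit_det A)
    exact (Finset.card_ne_zero.1 this).to_subtype
  have hset : ∀ {F : Set (RepSpace A)}, IsSelfAffine A D F →
      RepSpace.mulEquiv A '' F = ⋃ d : D, (fun z => z + t d) '' F := fun hF => by
    rw [RepSpace.coe_mulEquiv, hF.setEquation, hunion]
  refine ⟨⟨Set.range (codingMap (RepSpace.mulEquiv A) t), ⟨Set.range_nonempty _,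
    isCompact_range_codingMap t hcon, ?_⟩, fun F hF =>
      eq_range_codingMap t hcon hF.isCompact hF.nonempty (hset hF)⟩, fun F hF => ?_⟩
  · rw [hunion]
    exact image_range_codingMap t hcon
  · have hcard : (Fintype.card D : NNReal) ≤ addEquivAddHaarChar (RepSpace.mulEquiv A) := by
      rw [Fintype.card_coe, hD]
      exact residueCard_le_addHaarChar A
    tfae_have 1 → 2 := fun h =>
      interior_nonempty_of_measure_ne_zero (RepSpace.measure A) hcon (t := t)
        (Λ := (diagonalHom A).range) (fun _ => mulEquiv_mem_range_diagonalHom A) (finite_range_diagonalHom_inter A)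
        (fun d => ⟨d, rfl⟩) hF.isCompact (hset hF) h.ne'
    tfae_have 2 → 3 := fun h =>
      ⟨closure_interior_eq t hcon hF.isCompact (hset hF) h,
        measure_frontier_eq_zero (RepSpace.measure A) hcon hF.isCompact (hset hF) h hcard⟩
    tfae_have 3 → 1 := fun h => by
      have hi : (interior F).Nonempty := by
        rw [← closure_nonempty_iff, ← h.1]
        exact hF.nonempty
      exact (isOpen_interior.measure_pos (RepSpace.measure A) hi).trans_le
        (measure_mono interior_subset)
    tfae_finish
end
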